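/- Let $\omega=dz^1\wedge dz^3+dz^2\wedge dz^4$ on $\mathbb{C}^4$, let $\mathrm{Sp}(2,\mathbb{C})$ be its group of linear automorphisms, and let $\mathbb{Q}_3$ be the complex $3$-fold of Lagrangian planes of $(\mathbb{C}^4,\omega)$. For an $\mathrm{Sp}(2,\mathbb{C})$-valued map $A$ with columns $A_1,\dots,A_4$ write $dA_i=\varphi_i^jA_j$, i.e. $A^{-1}dA=(\varphi^j_i)$ with row index $j$ and column index $i$. An isotropic curve is a nonconstant holomorphic map $f:S\to\mathbb{Q}_3$ from a connected Riemann surface such that $\varphi^3_1\varphi^4_2-(\varphi^4_1)^2=0$ for all local holomorphic maps $A$ to $\mathrm{Sp}(2,\mathbb{C})$ with $f=[A_1\wedge A_2]$ (that is, $f$ is null for the $\mathrm{Sp}(2,\mathbb{C})$-invariant conformal structure of $\mathbb{Q}_3$), and such that $f(S)$ is not contained in a null ray $\{P\in\mathbb{Q}_3\mid \xi\in P\}$, $0\neq\xi\in\mathbb{C}^4$. A reduced frame of $f$ on an open set $U\subset S$ is a holomorphic map $A:U\to\mathrm{Sp}(2,\mathbb{C})$ with $f|_U=[A_1\wedge A_2]$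 and $$\varphi^3_1=\varphi^4_1=\varphi^2_1-\varphi^4_2=\varphi^1_1-3\varphi^2_2=4\varphi^1_2-3\varphi^2_4=\varphi^1_4=0,\qquad \varphi^4_2\neq0\text{ everywhere on }U.$$ Reduced frames exist locally on the complement of a closed discrete subset of $S$. The quartic differential of $f$ is the meromorphic differential $\delta$ of order $4$ on $S$ with $\delta=\varphi^1_3(\varphi^4_2)^3$ for every reduced frame, and $f$ is of general type if $\delta\not\equiv0$. A local coordinate $z:U\to\mathbb{C}$ is adapted to $f$ if there is a reduced frame on $U$ with $\varphi^2_2=\varphi^2_4=0$ and $-6^{-1/3}\varphi^4_2=dz$; adapted coordinates exist around every point around which there is a reduced frame, and form a projective atlas. The operator $\mathfrak d$ from quartic to quadratic meromorphic differentials is given in every adapted coordinate by $$\mathfrak d(Z\,dz^4)=\Big(\frac12\frac{Z''}{Z}-\frac9{16}\frac{Z'^2}{Z^2}\Big)dz^2,\qquad \mathfrak d(0)=0 .$$ Theorem. Let $f:S\to\mathbb{Q}_3$ and $\hat f:\hat S\to\mathbb{Q}_3$ be two isotropic curves of general type, with quartic differentials $\delta$, $\hat\delta$ and quadratic differentials $\mathfrak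 d(\delta)$, $\mathfrak d(\hat\delta)$, each formed with the operator $\mathfrak d$ of its own curve. Then $\hat f$ is dominated by $f$, i.e. there are a holomorphic map $h:\hat S\to S$ and $X\in\mathrm{Sp}(2,\mathbb{C})$ with $\hat f=X\cdot(f\circ h)$, if and only if there is a holomorphic map $h:\hat S\to S$ such that $h^*\delta=\hat\delta$ and $h^*\mathfrak d(\delta)=\mathfrak d(\hat\delta)$, as meromorphic differentials on $\hat S$. -/

import Mathlib

open scoped Manifold ContDiff

noncomputable section

namespace IsotropicCurves

/-! ### The symplectic group `Sp(2, ℂ)` and the quadric of Lagrangian planes -/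

/-- Index set of the natural basis of `ℂ⁴ = ℂ² ⊕ ℂ²`. -/
abbrev Idx : Type := Fin 2 ⊕ Fin 2

/-- The index of the first basis vector `e₁`. -/
abbrev ix₁ : Idx := Sum.inl 0
/-- The index of the second basis vector `e₂`. -/
abbrev ix₂ : Idx := Sum.inl 1
/-- The index of the third basis vector `e₃`. -/
abbrev ix₃ : Idx := Sum.inr 0
/-- The index of the fourth basis vector `e₄`. -/
abbrev ix₄ : Idx := Sum.inr 1

/-- The symplectic form `dz¹ ∧ dz³ + dz² ∧ dz⁴` on `ℂ⁴`. -/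
def sympForm (x y : Idx → ℂ) : ℂ :=
  (x ix₁ * y ix₃ - x ix₃ * y ix₁) + (x ix₂ * y ix₄ - x ix₄ * y ix₂)

/-- The group `Sp(2, ℂ)` of `4 × 4` matrices preserving `sympForm`. -/
abbrev Sp : Type := Matrix.symplecticGroup (Fin 2) ℂ

/-- The quadric `ℚ₃`: the set of Lagrangian planes of `(ℂ⁴, sympForm)`. -/
def Q3 : Type :=
  {P : Submodule ℂ (Idx → ℂ) //
    Module.finrank ℂ P = 2 ∧ ∀ x ∈ P, ∀ y ∈ P, sympForm x y = 0}

lemma sympForm_eq (x y : Idx → ℂ) :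
    sympForm x y = - (x ⬝ᵥ (Matrix.J (Fin 2) ℂ).mulVec y) := by
  simp [sympForm, Matrix.J, dotProduct, Matrix.mulVec, Fintype.sum_sum_type, Matrix.one_apply]
  ring

lemma sympForm_mulVec (X : Sp) (x y : Idx → ℂ) :
    sympForm (X.1.mulVec x) (X.1.mulVec y) = sympForm x y := by
  have h := SymplecticGroup.mem_iff'.1 X.2
  rw [sympForm_eq, sympForm_eq, Matrix.mulVec_mulVec, ← Matrix.vecMul_transpose,
    ← Matrix.dotProduct_mulVec, Matrix.mulVec_mulVec, ← Matrix.mul_assoc, h]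

lemma mulVec_injective (X : Sp) : Function.Injective X.1.mulVec :=
  Matrix.mulVec_injective_of_isUnit
    ((Matrix.isUnit_iff_isUnit_det _).2 (SymplecticGroup.symplectic_det X.2))

/-- The action of `Sp(2, ℂ)` on Lagrangian planes, `X • P = {X v | v ∈ P}`. -/
instance : SMul Sp Q3 where
  smul X P := ⟨P.1.map X.1.mulVecLin, by
    refine ⟨?_, ?_⟩
    · exact (LinearEquiv.finrank_eq (Submodule.equivMapOfInjective X.1.mulVecLin
        (mulVec_injective X) P.1)).symm.trans P.2.1
    · rintro _ ⟨x, hx, rfl⟩ _ ⟨y, hy, rfl⟩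
      exact (sympForm_mulVec X x y).trans (P.2.2 x hx y hy)⟩

section Curves

variable {S : Type*} [TopologicalSpace S] [ChartedSpace ℂ S]

/-! ### Symplectic frames and isotropic curves -/

/-- `A` is a symplectic frame along `f` on the open set `U`: a holomorphic map `A : U → Sp(2, ℂ)`
with `f = [A₁ ∧ A₂]` on `U`, where `Aⱼ` is the `j`-th column of `A`.
(The values of `A` outside `U` are irrelevant.) -/
structure IsSymplecticFrame (f : S → Q3) (U : Set S) (A : S → Sp) : Prop where
  isOpen : IsOpen U
  holomorphic : ∀ i j, MDifferentiableOn 𝓘(ℂ) 𝓘(ℂ) (fun p => (A p).1 i j) U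
  spans : ∀ p ∈ U,
    (f p).1 = Submodule.span ℂ {fun i => (A p).1 i ix₁, fun i => (A p).1 i ix₂}

/-- The pull-back by `A` of the Maurer-Cartan form of `Sp(2, ℂ)`, i.e. `φ = A⁻¹ dA`, evaluated on a
tangent vector `v` at `p`. The form `φʲᵢ` (with `dAᵢ = φʲᵢ Aⱼ`) is the entry in
row `j` and column `i`. -/
def mcForm (A : S → Sp) (p : S) (v : TangentSpace 𝓘(ℂ) p) : Matrix Idx Idx ℂ :=
  (A p).1⁻¹ * Matrix.of fun i j => (mfderiv 𝓘(ℂ) 𝓘(ℂ) (fun q => (A q).1 i j) p v : ℂ)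

/-- A map into `ℚ₃ = Sp(2, ℂ) / G₀` is holomorphic if and only if it lifts locally to a holomorphic
map into `Sp(2, ℂ)`, i.e. if and only if it has symplectic frames locally. -/
def IsHolomorphicCurve (f : S → Q3) : Prop :=
  ∀ p : S, ∃ U : Set S, p ∈ U ∧ ∃ A : S → Sp, IsSymplecticFrame f U A

/-- An isotropic curve: a nonconstant holomorphic map into `ℚ₃` along which the conformal structure
`(φ³₁ φ⁴₂ - (φ⁴₁)²) ⊗ (A₁ ∧ A₂)* ⊗ (A₃ ∧ A₄)` vanishes, and which is not (contained in) a null ray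
`{P | ξ ∈ P}`. -/
structure IsIsotropicCurve (f : S → Q3) : Prop where
  holomorphic : IsHolomorphicCurve f
  nonconstant : ¬ ∃ P : Q3, ∀ p, f p = P
  isotropic : ∀ (U : Set S) (A : S → Sp), IsSymplecticFrame f U A →
    ∀ p ∈ U, ∀ v : TangentSpace 𝓘(ℂ) p,
      mcForm A p v ix₃ ix₁ * mcForm A p v ix₄ ix₂ - mcForm A p v ix₄ ix₁ ^ 2 = 0
  not_nullRay : ¬ ∃ ξ : Idx → ℂ, ξ ≠ 0 ∧ ∀ p, ξ ∈ (f p).1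

/-- A holomorphic section `A : U → 𝓕` of the reduced frame bundle `𝓕` of `f`: a symplectic frame
along `f` on `U` that is an integral manifold of the Pfaffian system
`φ³₁ = φ⁴₁ = φ²₁ - φ⁴₂ = φ¹₁ - 3 φ²₂ = 4 φ¹₂ - 3 φ²₄ = φ¹₄ = 0`, `φ⁴₂ ≠ 0`. -/
structure IsReducedFrame (f : S → Q3) (U : Set S) (A : S → Sp) : Prop
    extends IsSymplecticFrame f U A where
  pfaff₁ : ∀ p ∈ U, ∀ v, mcForm A p v ix₃ ix₁ = 0
  pfaff₂ : ∀ p ∈ U, ∀ v, mcForm A p v ix₄ ix₁ = 0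
  pfaff₃ : ∀ p ∈ U, ∀ v, mcForm A p v ix₂ ix₁ - mcForm A p v ix₄ ix₂ = 0
  pfaff₄ : ∀ p ∈ U, ∀ v, mcForm A p v ix₁ ix₁ - 3 * mcForm A p v ix₂ ix₂ = 0
  pfaff₅ : ∀ p ∈ U, ∀ v, 4 * mcForm A p v ix₁ ix₂ - 3 * mcForm A p v ix₂ ix₄ = 0
  pfaff₆ : ∀ p ∈ U, ∀ v, mcForm A p v ix₁ ix₄ = 0
  independence : ∀ p ∈ U, ∀ v, v ≠ 0 → mcForm A p v ix₄ ix₂ ≠ 0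

end Curves

/-! ### Differentials of order `q` -/

/-- A differential of order `q` on the Riemann surface `S`: a section of `(T*S)^q`, written as a
function on tangent vectors that is homogeneous of degree `q`. A meromorphic differential is given
in this way by its values off a closed discrete set, with arbitrary values on this set; such
sections are therefore only compared through `Differential.AEq`. -/
structure Differential (q : ℕ) (S : Type*) [TopologicalSpace S] [ChartedSpace ℂ S] where
  /-- The value on a tangent vector `v` at `p`. -/
  val : ∀ p : S, TangentSpace 𝓘(ℂ) p → ℂ
  homogeneous : ∀ (p : S) (c : ℂ) (v : TangentSpace 𝓘(ℂ) p), val p (c • v) = c ^ q * val p v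

section Differentials

variable {q : ℕ} {S : Type*} [TopologicalSpace S] [ChartedSpace ℂ S]
  {S' : Type*} [TopologicalSpace S'] [ChartedSpace ℂ S']

/-- Equality of meromorphic differentials: equality off a closed discrete set. -/
def Differential.AEq (σ τ : Differential q S) : Prop :=
  ∀ᶠ p in Filter.codiscrete S, ∀ v, σ.val p v = τ.val p v

/-- The zero differential. -/
def Differential.zero (q : ℕ) (S : Type*) [TopologicalSpace S] [ChartedSpace ℂ S] :
    Differential q S where
  val _ _ := 0
  homogeneous _ _ _ := by simp

/-- The pull-back `h^* σ` of a differential by a holomorphic map `h`. -/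
def Differential.pullback (h : S' → S) (σ : Differential q S) : Differential q S' where
  val p v := σ.val (h p) (mfderiv 𝓘(ℂ) 𝓘(ℂ) h p v)
  homogeneous p c v := by rw [map_smul, σ.homogeneous]

/-- The coefficient of a differential in the chart `z` of `S`: the function `Z` on the image of the
chart such that `σ = Z dz^q`, i.e. the value of `σ` on `∂/∂z`. -/
def Differential.coeff (σ : Differential q S) (z : OpenPartialHomeomorph S ℂ) (w : ℂ) : ℂ :=
  σ.val (z.symm w) (mfderiv 𝓘(ℂ) 𝓘(ℂ) z.symm w (1 : ℂ))

/-- The `1`-form `dz` of a chart `z`. -/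
def chartForm (z : OpenPartialHomeomorph S ℂ) (p : S) (v : TangentSpace 𝓘(ℂ) p) : ℂ :=
  mfderiv 𝓘(ℂ) 𝓘(ℂ) z p v

/-- The value at `p` of the quadratic differential `(Z''/(2 Z) - 9 Z'^2 / (16 Z^2)) dz^2`, where
`σ = Z dz^4` in the chart `z`. -/
def chartOperator (z : OpenPartialHomeomorph S ℂ) (σ : Differential 4 S)
    (p : S) (v : TangentSpace 𝓘(ℂ) p) : ℂ :=
  (1 / 2 * (deriv (deriv (σ.coeff z)) (z p) / σ.coeff z (z p))
    - 9 / 16 * (deriv (σ.coeff z) (z p) ^ 2 / σ.coeff z (z p) ^ 2)) * chartForm z p v ^ 2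

end Differentials

section Invariants

variable {S : Type*} [TopologicalSpace S] [ChartedSpace ℂ S]

lemma mcForm_smul (A : S → Sp) (p : S) (c : ℂ) (v : TangentSpace 𝓘(ℂ) p) (i j : Idx) :
    mcForm A p (c • v) i j = c * mcForm A p v i j := by
  simp only [mcForm, Matrix.mul_apply, map_smul, Finset.mul_sum]
  refine Finset.sum_congr rfl fun k _ => ?_
  exact mul_left_comm _ c _

open Classical in
/-- The quartic differential `δ` of `f`: its pull-back to the reduced frame bundle `𝓕` is
`φ¹₃ (φ⁴₂)³`, so that `δ = φ¹₃ (φ⁴₂)³` for any section of `𝓕` around the point. The value is set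
to `0` at the points around which `𝓕` has no section, namely the critical points of `f` and of its
Legendre associate. -/
def quarticDifferential (f : S → Q3) : Differential 4 S where
  val p v :=
    if h : ∃ A : S → Sp, ∃ U : Set S, p ∈ U ∧ IsReducedFrame f U A then
      mcForm h.choose p v ix₁ ix₃ * mcForm h.choose p v ix₄ ix₂ ^ 3
    else 0
  homogeneous p c v := by
    split_ifs with h
    · rw [mcForm_smul, mcForm_smul]; ring
    · simp

/-- An isotropic curve is of general type if its quartic differential is not zero. -/
def IsGeneralType (f : S → Q3) : Prop :=
  ¬ (quarticDifferential f).AEq (Differential.zero 4 S)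

/-- The pull-back by a section `A` of `𝓕` of the Cartan connection
`η = φ²₂ (a¹₁ - a²₂) - 6^(-1/3) φ⁴₂ a¹₂ - (3/32)^(1/3) φ²₄ a²₁` with values in the trace-free
`2 × 2` matrices; `φ⁴₂` stands in the lower left corner and `φ²₄` in the upper right corner. -/
def cartanForm (A : S → Sp) (p : S) (v : TangentSpace 𝓘(ℂ) p) : Matrix (Fin 2) (Fin 2) ℂ :=
  !![mcForm A p v ix₂ ix₂,
      -(((3 / 32 : ℝ) ^ (1 / 3 : ℝ) : ℝ) : ℂ) * mcForm A p v ix₂ ix₄;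
    -(((6 : ℝ) ^ (-(1 / 3) : ℝ) : ℝ) : ℂ) * mcForm A p v ix₄ ix₂,
      - mcForm A p v ix₂ ix₂]

/-- The chart `z` of `S` is adapted to the projective structure `(𝓕, η)` of `f`: on its domain
there is a flat section `A` of `𝓕`, i.e. one such that the pull-back of `η` is `dz` times the
elementary matrix with `1` in the lower left corner. -/
def IsAdaptedChart (f : S → Q3) (z : OpenPartialHomeomorph S ℂ) : Prop :=
  z ∈ IsManifold.maximalAtlas 𝓘(ℂ) ω S ∧
    ∃ A : S → Sp, IsReducedFrame f z.source A ∧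
      ∀ p ∈ z.source, ∀ v, cartanForm A p v = !![0, 0; chartForm z p v, 0]

open Classical in
/-- The second order operator `𝔡` of the projective structure of `f`, from quartic to quadratic
differentials. At a point in the domain of an adapted chart `z` it is
`𝔡 (Z dz^4) = (Z''/(2 Z) - 9 Z'^2 / (16 Z^2)) dz^2`, for any such `z`; elsewhere (at the critical
points of `f` and of its Legendre associate) the value is set to `0`. -/
def projectiveOperator (f : S → Q3) (σ : Differential 4 S) : Differential 2 S where
  val p v :=
    if h : ∃ z : OpenPartialHomeomorph S ℂ, p ∈ z.source ∧ IsAdaptedChart f z then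
      chartOperator h.choose σ p v
    else 0
  homogeneous p c v := by
    split_ifs with h
    · have : chartForm h.choose p (c • v) = c * chartForm h.choose p v := by
        simp only [chartForm, map_smul]; rfl
      rw [chartOperator, chartOperator, this]; ring
    · simp

/-- `f'` is dominated by `f`: `f' = X · f ∘ h` for a holomorphic map `h` and some
`X ∈ Sp(2, ℂ)`. -/
def IsDominatedBy {S' : Type*} [TopologicalSpace S'] [ChartedSpace ℂ S']
    (f' : S' → Q3) (f : S → Q3) : Prop :=
  ∃ h : S' → S, MDifferentiable 𝓘(ℂ) 𝓘(ℂ) h ∧ ∃ X : Sp, ∀ p, f' p = X • f (h p)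

end Invariants

end IsotropicCurves

end

/-!
A reduced frame of an isotropic curve, written in a coordinate `w` of the surface, is a solution of
`G' = G M` with `M = k H + m F + s E + r R`, where `H`, `E`, `F` span the principal `𝔰𝔩₂` of
`𝔰𝔭(2, ℂ)` and `R` is its highest root vector (`MovingFrame`). Reduced frames of the same curve are
related by gauge transformations in the upper triangular subgroup of the principal `SL₂`. The torus
and the unipotent part of this subgroup bring any frame to the normal form `k = 0`,
`m = -6^(1/3)` (`MovingFrame.exists_normalFrame`), and in this form the frame is unique up to sign,
so that `s` and `r` depend only on the curve and on the coordinate (`NormalFrame.unique`). They form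
a complete set of local invariants: if `s` and `r` agree for two curves, then `G' G⁻¹` is constant
for their normal frames `G`, `G'`, and the curves are congruent (`NormalFrame.congruent`).

The theorem follows because `δ` and `𝔡(δ)` carry exactly this information. In any coordinate
`δ = m³ r dw⁴` with `m = -6^(1/3)`. Under a change of coordinate `s` transforms by the Schwarzian
derivative (`MovingFrame.normal_comp`), and so does the expression `Z''/(2 Z) - 9 Z'²/(16 Z²)` formed
with `Z = m³ r` (`coordOperator_comp`). An adapted chart is one with `s = 0`; the two anomalies
cancel, and in any coordinate `𝔡(δ)` is `(Z''/(2 Z) - 9 Z'²/(16 Z²) + m s) dw²`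
(`projectiveOperator_coeff`). Adapted charts exist near every point with a reduced frame because a
coordinate with prescribed Schwarzian derivative is obtained from a power series solution of
`u'' + q u = 0` (`exists_schwarzian_eq`).

If `f' = X • f ∘ h`, then at a noncritical point of `h` the composition of `h` with a parametrization
of `S'` is a parametrization of `S`, and the two curves have the same normal frames up to `X`; if
there are none, all the differentials are `0` at this point by convention. The critical points of the
nonconstant map `h` are isolated (`eventually_mfderiv_ne_zero`). Conversely, if `h` matches the
differentials, then near a point with `δ' ≠ 0` the map `h` is a local biholomorphism, both curves have
normal frames, and the invariants `r` and `s` agree, so that `f' = X • f ∘ h` near this point. By the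
identity principle this holds on the connected surface `S'` (`congruent_of_eventually`).
-/

noncomputable section

namespace IsotropicCurves

open Filter Topology Matrix

/-! ### Planes spanned by symplectic frames -/

/-- The Lagrangian plane `[A₁ ∧ A₂]` spanned by the first two columns of `A`. -/
def frameSpan (A : Sp) : Submodule ℂ (Idx → ℂ) :=
  Submodule.span ℂ {fun i => A.1 i ix₁, fun i => A.1 i ix₂}

lemma Sp.isUnit_det (A : Sp) : IsUnit A.1.det := SymplecticGroup.symplectic_det A.2

lemma Sp.mul_inv (A : Sp) : A.1 * A.1⁻¹ = 1 := Matrix.mul_nonsing_inv _ A.isUnit_det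

lemma Sp.inv_mul (A : Sp) : A.1⁻¹ * A.1 = 1 := Matrix.nonsing_inv_mul _ A.isUnit_det

lemma mem_frameSpan_iff (A : Sp) (v : Idx → ℂ) :
    v ∈ frameSpan A ↔ ∀ i, (A.1⁻¹ *ᵥ v) (Sum.inr i) = 0 := by
  rw [frameSpan, Submodule.mem_span_pair]
  constructor
  · rintro ⟨a, b, rfl⟩ i
    have h : ∀ j : Idx, A.1⁻¹ *ᵥ (fun k => A.1 k j) = fun k => (1 : Matrix Idx Idx ℂ) k j := by
      intro j
      ext k
      rw [← A.inv_mul, Matrix.mul_apply]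
      rfl
    rw [Matrix.mulVec_add, Matrix.mulVec_smul, Matrix.mulVec_smul, h, h]
    simp
  · intro h
    refine ⟨(A.1⁻¹ *ᵥ v) ix₁, (A.1⁻¹ *ᵥ v) ix₂, ?_⟩
    have hv : v = A.1 *ᵥ (A.1⁻¹ *ᵥ v) := by
      rw [Matrix.mulVec_mulVec, A.mul_inv, Matrix.one_mulVec]
    generalize A.1⁻¹ *ᵥ v = x at h hv
    subst hv
    ext k
    simp [Matrix.mulVec, dotProduct, Fintype.sum_sum_type, h, mul_comm]

lemma frameSpan_le_iff (A B : Sp) :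
    frameSpan B ≤ frameSpan A ↔ ∀ i j, (A.1⁻¹ * B.1) (Sum.inr i) (Sum.inl j) = 0 := by
  rw [frameSpan, Submodule.span_le]
  simp only [Set.insert_subset_iff, Set.singleton_subset_iff, SetLike.mem_coe, mem_frameSpan_iff]
  constructor
  · rintro ⟨h₁, h₂⟩ i j
    fin_cases j
    · exact h₁ i
    · exact h₂ i
  · intro h
    exact ⟨fun i => h i 0, fun i => h i 1⟩

lemma finrank_frameSpan (A : Sp) : Module.finrank ℂ (frameSpan A) = 2 := by
  have hli : LinearIndependent ℂ ![fun i => A.1 i ix₁, fun i => A.1 i ix₂] := by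
    have h := (Matrix.linearIndependent_cols_of_isUnit
      ((Matrix.isUnit_iff_isUnit_det _).2 A.isUnit_det)).comp Sum.inl Sum.inl_injective
    convert! h using 1
    ext j i
    fin_cases j <;> rfl
  have := finrank_span_eq_card hli
  rw [frameSpan, ← Matrix.range_cons_cons_empty _ _ ![], this, Fintype.card_fin]

lemma frameSpan_eq_iff (A B : Sp) :
    frameSpan B = frameSpan A ↔ ∀ i j, (A.1⁻¹ * B.1) (Sum.inr i) (Sum.inl j) = 0 := by
  rw [← frameSpan_le_iff]
  refine ⟨fun h => h.le, fun h => ?_⟩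
  exact Submodule.eq_of_le_of_finrank_eq h
    ((finrank_frameSpan B).trans (finrank_frameSpan A).symm)

lemma frameSpan_mul (A g : Sp) (hg : ∀ i j, g.1 (Sum.inr i) (Sum.inl j) = 0) :
    frameSpan (A * g) = frameSpan A := by
  rw [frameSpan_eq_iff]
  intro i j
  rw [Submonoid.coe_mul, ← Matrix.mul_assoc, A.inv_mul, Matrix.one_mul, hg]

lemma smul_val (X : Sp) (P : Q3) : (X • P).1 = P.1.map X.1.mulVecLin := rfl

lemma map_frameSpan (X A : Sp) : (frameSpan A).map X.1.mulVecLin = frameSpan (X * A) := by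
  rw [frameSpan, Submodule.map_span, Set.image_pair]
  rfl

lemma smul_eq_iff (X A B : Sp) (P Q : Q3) (hP : P.1 = frameSpan A) (hQ : Q.1 = frameSpan B) :
    Q = X • P ↔ ∀ i j, ((X * A).1⁻¹ * B.1) (Sum.inr i) (Sum.inl j) = 0 := by
  rw [← frameSpan_eq_iff, ← map_frameSpan, ← hP, ← hQ, ← smul_val]
  exact Subtype.ext_iff

/-! ### Differentiation of matrix-valued functions -/

/-- The matrix-valued function `G` has at `w` the derivative `D`, entry by entry. -/
def HasMatrixDerivAt (G : ℂ → Matrix Idx Idx ℂ) (D : Matrix Idx Idx ℂ) (w : ℂ) : Prop :=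
  ∀ i j, HasDerivAt (fun z => G z i j) (D i j) w

namespace HasMatrixDerivAt

variable {G H : ℂ → Matrix Idx Idx ℂ} {D E : Matrix Idx Idx ℂ} {w : ℂ}

lemma mul (hG : HasMatrixDerivAt G D w) (hH : HasMatrixDerivAt H E w) :
    HasMatrixDerivAt (fun z => G z * H z) (D * H w + G w * E) w := by
  intro i j
  simp only [Matrix.mul_apply, Matrix.add_apply, ← Finset.sum_add_distrib]
  exact HasDerivAt.fun_sum fun k _ => (hG i k).mul (hH k j)

lemma unique (hG : HasMatrixDerivAt G D w) (hG' : HasMatrixDerivAt G E w) : D = E := by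
  ext i j
  exact (hG i j).unique (hG' i j)

lemma congr_eventuallyEq (hG : HasMatrixDerivAt G D w) (h : H =ᶠ[𝓝 w] G) :
    HasMatrixDerivAt H D w := by
  intro i j
  exact (hG i j).congr_of_eventuallyEq (h.mono fun z hz => congrFun (congrFun hz i) j)

lemma const (C : Matrix Idx Idx ℂ) (w : ℂ) : HasMatrixDerivAt (fun _ => C) 0 w :=
  fun _ _ => hasDerivAt_const _ _

lemma comp_scalar {ν : ℂ → ℂ} {ν' y : ℂ} (hG : HasMatrixDerivAt G D (ν y))
    (hν : HasDerivAt ν ν' y) : HasMatrixDerivAt (fun z => G (ν z)) (ν' • D) y := by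
  intro i j
  have := (hG i j).comp y hν
  rw [mul_comm] at this
  exact this

end HasMatrixDerivAt

lemma inv_eq_of_mem (A : Sp) : A.1⁻¹ = -J (Fin 2) ℂ * A.1ᵀ * J (Fin 2) ℂ :=
  SymplecticGroup.inv_eq_symplectic_inv _ A.2

/-- If `G' = G M` along a curve of symplectic matrices, then `(G⁻¹)' = - M G⁻¹`. -/
lemma HasMatrixDerivAt.inv {G : ℂ → Sp} {M : Matrix Idx Idx ℂ} {w : ℂ}
    (hG : HasMatrixDerivAt (fun z => (G z).1) ((G w).1 * M) w) :
    HasMatrixDerivAt (fun z => (G z).1⁻¹) (-(M * (G w).1⁻¹)) w := by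
  have hT : HasMatrixDerivAt (fun z => (G z).1ᵀ) ((G w).1 * M)ᵀ w := fun i j => hG j i
  obtain ⟨K, hK⟩ : ∃ K, HasMatrixDerivAt (fun z => (G z).1⁻¹) K w := by
    simp only [inv_eq_of_mem]
    exact ⟨_, ((HasMatrixDerivAt.const (-J (Fin 2) ℂ) w).mul hT).mul
      (HasMatrixDerivAt.const (J (Fin 2) ℂ) w)⟩
  have h1 := (hK.mul hG).unique
    ((HasMatrixDerivAt.const 1 w).congr_eventuallyEq
      (Eventually.of_forall fun z => (G z).inv_mul))
  rw [← Matrix.mul_assoc (G w).1⁻¹, (G w).inv_mul, Matrix.one_mul] at h1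
  have h2 := congrArg (· * (G w).1⁻¹) (eq_neg_of_add_eq_zero_left h1)
  simp only [Matrix.mul_assoc, (G w).mul_inv, Matrix.mul_one, Matrix.neg_mul] at h2
  rwa [h2] at hK

/-! ### Moving frames in a coordinate and their gauge transformations -/

/-- The general element `k H + m F + s E + r R` of `𝔰𝔭(2, ℂ)` satisfying the linear equations of
the reduced frame bundle; here `H`, `E`, `F` span the principal `𝔰𝔩₂` and `R` is the highest root
vector. The entries are `k = φ²₂`, `m = φ⁴₂`, `s = φ²₄`, `r = φ¹₃`. -/
def reducedForm (k m s r : ℂ) : Matrix Idx Idx ℂ :=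
  Matrix.fromBlocks !![3 * k, 3 / 4 * s; m, k] !![r, 0; 0, s]
    !![0, 0; 0, m] !![-3 * k, -m; -(3 / 4) * s, -k]

/-- In a coordinate around `w₀`, the curve `γ` in `ℚ₃` is spanned by the first two columns of the
reduced symplectic frame `G`, whose Maurer-Cartan form is `reducedForm k m s r · dw`. -/
structure MovingFrame (γ : ℂ → Q3) (w₀ : ℂ) (G : ℂ → Sp) (k m s r : ℂ → ℂ) : Prop where
  analytic_k : AnalyticAt ℂ k w₀
  analytic_m : AnalyticAt ℂ m w₀
  analytic_s : AnalyticAt ℂ s w₀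
  analytic_r : AnalyticAt ℂ r w₀
  m_ne_zero : m w₀ ≠ 0
  spans : ∀ᶠ w in 𝓝 w₀, (γ w).1 = frameSpan (G w)
  hasDeriv : ∀ᶠ w in 𝓝 w₀, HasMatrixDerivAt (fun z => (G z).1)
    ((G w).1 * reducedForm (k w) (m w) (s w) (r w)) w

namespace MovingFrame

variable {γ : ℂ → Q3} {w₀ : ℂ} {G : ℂ → Sp} {k m s r : ℂ → ℂ}

lemma eventually (h : MovingFrame γ w₀ G k m s r) :
    ∀ᶠ w in 𝓝 w₀, MovingFrame γ w G k m s r := by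
  filter_upwards [h.analytic_k.eventually_analyticAt, h.analytic_m.eventually_analyticAt,
    h.analytic_s.eventually_analyticAt, h.analytic_r.eventually_analyticAt,
    h.analytic_m.continuousAt.eventually_ne h.m_ne_zero,
    eventually_eventually_nhds.2 h.spans, eventually_eventually_nhds.2 h.hasDeriv]
    with w h1 h2 h3 h4 h5 h6 h7
  exact ⟨h1, h2, h3, h4, h5, h6, h7⟩

lemma congr_data {k' m' s' r' : ℂ → ℂ} (h : MovingFrame γ w₀ G k m s r)
    (hk : k' =ᶠ[𝓝 w₀] k) (hm : m' =ᶠ[𝓝 w₀] m) (hs : s' =ᶠ[𝓝 w₀] s) (hr : r' =ᶠ[𝓝 w₀] r) :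
    MovingFrame γ w₀ G k' m' s' r' := by
  refine ⟨h.analytic_k.congr hk.symm, h.analytic_m.congr hm.symm, h.analytic_s.congr hs.symm,
    h.analytic_r.congr hr.symm, by rw [hm.eq_of_nhds]; exact h.m_ne_zero, h.spans, ?_⟩
  filter_upwards [h.hasDeriv, hk, hm, hs, hr] with w hw h1 h2 h3 h4
  rwa [h1, h2, h3, h4]

lemma congr_curve {γ' : ℂ → Q3} (h : MovingFrame γ w₀ G k m s r) (hγ : γ' =ᶠ[𝓝 w₀] γ) :
    MovingFrame γ' w₀ G k m s r := by
  refine ⟨h.analytic_k, h.analytic_m, h.analytic_s, h.analytic_r, h.m_ne_zero, ?_, h.hasDeriv⟩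
  filter_upwards [h.spans, hγ] with w h1 h2
  rw [h2, h1]

/-- The action of `Sp(2, ℂ)` does not change the Maurer-Cartan form. -/
lemma smul (h : MovingFrame γ w₀ G k m s r) (X : Sp) :
    MovingFrame (fun w => X • γ w) w₀ (fun w => X * G w) k m s r := by
  refine ⟨h.analytic_k, h.analytic_m, h.analytic_s, h.analytic_r, h.m_ne_zero, ?_, ?_⟩
  · filter_upwards [h.spans] with w hw
    rw [smul_val, hw, map_frameSpan]
  · filter_upwards [h.hasDeriv] with w hw
    have := (HasMatrixDerivAt.const X.1 w).mul hw
    rw [Matrix.zero_mul, zero_add, ← Matrix.mul_assoc] at this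
    exact this

/-- Change of frame: `φ` is replaced by `g⁻¹ φ g + g⁻¹ dg`. -/
lemma gauge (h : MovingFrame γ w₀ G k m s r) (g : ℂ → Sp) (g' : ℂ → Matrix Idx Idx ℂ)
    {k' m' s' r' : ℂ → ℂ} (hk : AnalyticAt ℂ k' w₀) (hm : AnalyticAt ℂ m' w₀)
    (hs : AnalyticAt ℂ s' w₀) (hr : AnalyticAt ℂ r' w₀) (hm0 : m' w₀ ≠ 0)
    (hg : ∀ w i j, (g w).1 (Sum.inr i) (Sum.inl j) = 0)
    (hgd : ∀ᶠ w in 𝓝 w₀, HasMatrixDerivAt (fun z => (g z).1) (g' w) w)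
    (hgg : ∀ᶠ w in 𝓝 w₀, reducedForm (k w) (m w) (s w) (r w) * (g w).1 + g' w =
      (g w).1 * reducedForm (k' w) (m' w) (s' w) (r' w)) :
    MovingFrame γ w₀ (fun w => G w * g w) k' m' s' r' := by
  refine ⟨hk, hm, hs, hr, hm0, ?_, ?_⟩
  · filter_upwards [h.spans] with w hw
    rw [hw, frameSpan_mul _ _ (hg w)]
  · filter_upwards [h.hasDeriv, hgd, hgg] with w h1 h2 h3
    have := h1.mul h2
    rw [Matrix.mul_assoc, ← Matrix.mul_add, h3, ← Matrix.mul_assoc] at this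
    exact this

end MovingFrame

/-- The element `diag(t³, t, t⁻³, t⁻¹)` of the principal torus. -/
def torusMatrix (t : ℂ) : Matrix Idx Idx ℂ :=
  Matrix.fromBlocks !![t ^ 3, 0; 0, t] 0 0 !![(t⁻¹) ^ 3, 0; 0, t⁻¹]

/-- The element `exp (u E)` of the principal unipotent subgroup. -/
def unipotentMatrix (u : ℂ) : Matrix Idx Idx ℂ :=
  Matrix.fromBlocks !![1, 3 / 4 * u; 0, 1]
    !![-(3 / 32) * u ^ 3, 3 / 8 * u ^ 2; -(3 / 8) * u ^ 2, u]
    0 !![1, 0; -(3 / 4) * u, 1]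

lemma fromBlocks_mem_symplecticGroup {P Q D : Matrix (Fin 2) (Fin 2) ℂ} (h₁ : P * Dᵀ = 1)
    (h₂ : P * Qᵀ = Q * Pᵀ) : Matrix.fromBlocks P Q 0 D ∈ Matrix.symplecticGroup (Fin 2) ℂ := by
  have h₃ : D * Pᵀ = 1 := by
    have := congrArg Matrix.transpose h₁
    rwa [Matrix.transpose_mul, Matrix.transpose_transpose, Matrix.transpose_one] at this
  rw [SymplecticGroup.mem_iff, Matrix.J, Matrix.fromBlocks_transpose, Matrix.fromBlocks_multiply,
    Matrix.fromBlocks_multiply]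
  simp [h₁, h₃, h₂]

lemma torusMatrix_mem {t : ℂ} (ht : t ≠ 0) :
    torusMatrix t ∈ Matrix.symplecticGroup (Fin 2) ℂ := by
  refine fromBlocks_mem_symplecticGroup ?_ (by simp)
  ext i j
  fin_cases i <;> fin_cases j <;> simp [Matrix.mul_apply, ht]

lemma unipotentMatrix_mem (u : ℂ) : unipotentMatrix u ∈ Matrix.symplecticGroup (Fin 2) ℂ := by
  refine fromBlocks_mem_symplecticGroup ?_ ?_ <;>
  · ext i j
    fin_cases i <;> fin_cases j <;> simp [Matrix.mul_apply] <;> try ring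

namespace MovingFrame

variable {γ : ℂ → Q3} {w₀ : ℂ} {G : ℂ → Sp} {k m s r : ℂ → ℂ}

lemma gauge_torus (h : MovingFrame γ w₀ G k m s r) {t : ℂ → ℂ} (ht : AnalyticAt ℂ t w₀)
    (ht0 : t w₀ ≠ 0) : ∃ G', MovingFrame γ w₀ G' (fun w => k w + deriv t w / t w)
      (fun w => m w * t w ^ 2) (fun w => s w / t w ^ 2) (fun w => r w / t w ^ 6) := by
  classical
  let g : ℂ → Sp := fun w => if hw : t w ≠ 0 then ⟨torusMatrix (t w), torusMatrix_mem hw⟩ else 1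
  have hgt : ∀ᶠ w in 𝓝 w₀, (g w).1 = torusMatrix (t w) := by
    filter_upwards [ht.continuousAt.eventually_ne ht0] with w hw
    simp [g, hw]
  refine ⟨_, h.gauge g (fun w => Matrix.fromBlocks !![3 * t w ^ 2 * deriv t w, 0; 0, deriv t w] 0 0
    !![-3 * (t w)⁻¹ ^ 4 * deriv t w, 0; 0, -(t w)⁻¹ ^ 2 * deriv t w])
    (h.analytic_k.add (ht.deriv.div ht ht0))
    (h.analytic_m.mul (ht.pow 2)) (h.analytic_s.div (ht.pow 2) (pow_ne_zero _ ht0))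
    (h.analytic_r.div (ht.pow 6) (pow_ne_zero _ ht0))
    (mul_ne_zero h.m_ne_zero (pow_ne_zero _ ht0)) ?_ ?_ ?_⟩
  · intro w i j
    by_cases hw : t w = 0 <;> simp [g, hw, torusMatrix]
  · filter_upwards [eventually_eventually_nhds.2 hgt, ht.eventually_analyticAt,
      ht.continuousAt.eventually_ne ht0] with w h1 h2 h3
    refine HasMatrixDerivAt.congr_eventuallyEq ?_ h1
    have hd : HasDerivAt t (deriv t w) w := h2.differentiableAt.hasDerivAt
    have hi := hd.fun_inv h3
    rintro (i | i) (j | j) <;> fin_cases i <;> fin_cases j <;>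
      simp only [torusMatrix, Matrix.fromBlocks_apply₁₁, Matrix.fromBlocks_apply₁₂,
        Matrix.fromBlocks_apply₂₁, Matrix.fromBlocks_apply₂₂, Fin.zero_eta, Fin.mk_one,
        Matrix.of_apply, Matrix.cons_val', Matrix.cons_val_zero, Matrix.cons_val_one,
        Matrix.cons_val_fin_one, Matrix.zero_apply] <;>
      try exact hasDerivAt_const _ _
    · exact (hd.fun_pow 3).congr_deriv (by norm_num)
    · exact hd
    · exact (hi.fun_pow 3).congr_deriv (by norm_num; field_simp)
    · convert! hi using 1
      field_simp
  · filter_upwards [hgt, ht.continuousAt.eventually_ne ht0] with w h1 h3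
    rw [h1]
    simp only [torusMatrix, reducedForm, Matrix.fromBlocks_multiply, Matrix.fromBlocks_add]
    congr 1 <;> ext i j <;> fin_cases i <;> fin_cases j <;> simp <;>
      field_simp <;> try ring

lemma gauge_unipotent (h : MovingFrame γ w₀ G k m s r) {u : ℂ → ℂ} (hu : AnalyticAt ℂ u w₀) :
    ∃ G', MovingFrame γ w₀ G' (fun w => k w - m w * u w / 4) m
      (fun w => s w + 2 * u w * k w - m w * u w ^ 2 / 4 + deriv u w) r := by
  refine ⟨_, h.gauge (fun w => ⟨unipotentMatrix (u w), unipotentMatrix_mem _⟩)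
    (fun w => Matrix.fromBlocks !![0, 3 / 4 * deriv u w; 0, 0]
    !![-(3 / 32) * (3 * u w ^ 2 * deriv u w), 3 / 8 * (2 * u w * deriv u w);
      -(3 / 8) * (2 * u w * deriv u w), deriv u w]
    0 !![0, 0; -(3 / 4) * deriv u w, 0])
    ?_ h.analytic_m ?_ h.analytic_r h.m_ne_zero ?_ ?_ ?_⟩
  · have h1 := h.analytic_k
    have h2 := h.analytic_m
    fun_prop
  · have h1 := h.analytic_k
    have h2 := h.analytic_m
    have h3 := h.analytic_s
    have h4 := hu.deriv
    fun_prop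
  · intro w i j
    simp [unipotentMatrix]
  · filter_upwards [hu.eventually_analyticAt] with w h2
    have hd : HasDerivAt u (deriv u w) w := h2.differentiableAt.hasDerivAt
    have hd2 : HasDerivAt (fun z => u z ^ 2) (2 * u w * deriv u w) w := by
      simpa using hd.fun_pow 2
    have hd3 : HasDerivAt (fun z => u z ^ 3) (3 * u w ^ 2 * deriv u w) w := by
      simpa using hd.fun_pow 3
    rintro (i | i) (j | j) <;> fin_cases i <;> fin_cases j <;>
      simp only [unipotentMatrix, Matrix.fromBlocks_apply₁₁, Matrix.fromBlocks_apply₁₂,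
        Matrix.fromBlocks_apply₂₁, Matrix.fromBlocks_apply₂₂, Fin.zero_eta, Fin.mk_one,
        Matrix.of_apply, Matrix.cons_val', Matrix.cons_val_zero, Matrix.cons_val_one,
        Matrix.cons_val_fin_one, Matrix.zero_apply] <;>
      first
        | exact hasDerivAt_const _ _
        | exact hd
        | exact hd.const_mul _
        | exact hd2.const_mul _
        | exact hd3.const_mul _
  · refine Eventually.of_forall fun w => ?_
    simp only [unipotentMatrix, reducedForm, Matrix.fromBlocks_multiply, Matrix.fromBlocks_add]
    congr 1 <;> ext i j <;> fin_cases i <;> fin_cases j <;> simp <;> try ring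

end MovingFrame

/-! ### Normal frames and changes of coordinate -/

/-- The constant value `-6^(1/3)` of `φ⁴₂(∂/∂w)` for a normal frame; this is the value for which
`-6^(-1/3) φ⁴₂ = dw`. -/
def normalScale : ℂ := -(((6 : ℝ) ^ (1 / 3 : ℝ) : ℝ) : ℂ)

lemma normalScale_ne_zero : normalScale ≠ 0 := by
  rw [normalScale, neg_ne_zero, Complex.ofReal_ne_zero]
  positivity

lemma neg_mul_normalScale : -(((6 : ℝ) ^ (-(1 / 3) : ℝ) : ℝ) : ℂ) * normalScale = 1 := by
  rw [normalScale, neg_mul_neg, ← Complex.ofReal_mul, ← Real.rpow_add (by norm_num)]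
  norm_num

/-- A reduced frame with `φ²₂ = 0` and `φ⁴₂ = normalScale · dw`. Such a frame is determined up to
sign by the curve and the coordinate, hence so are `s` and `r`. -/
abbrev NormalFrame (γ : ℂ → Q3) (w₀ : ℂ) (G : ℂ → Sp) (s r : ℂ → ℂ) : Prop :=
  MovingFrame γ w₀ G (fun _ => 0) (fun _ => normalScale) s r

lemma exists_analytic_sqrt {a : ℂ → ℂ} {w₀ : ℂ} (ha : AnalyticAt ℂ a w₀) (ha0 : a w₀ ≠ 0) :
    ∃ t : ℂ → ℂ, AnalyticAt ℂ t w₀ ∧ t w₀ ≠ 0 ∧ ∀ w, t w ^ 2 = a w := by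
  obtain ⟨c, hc⟩ := IsAlgClosed.exists_pow_nat_eq (a w₀) (n := 2) (by norm_num)
  have hsq : ∀ w, (c * (a w / a w₀) ^ (((2 : ℕ) : ℂ)⁻¹)) ^ 2 = a w := fun w => by
    rw [mul_pow, Complex.cpow_nat_inv_pow _ (by norm_num), hc, mul_div_cancel₀ _ ha0]
  refine ⟨fun w => c * (a w / a w₀) ^ (((2 : ℕ) : ℂ)⁻¹), ?_, ?_, hsq⟩
  · refine analyticAt_const.mul ((ha.div analyticAt_const ha0).cpow analyticAt_const ?_)
    simp [ha0]
  · intro h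
    apply ha0
    rw [← hsq w₀]
    simp only at h
    rw [h]
    norm_num

/-- The logarithmic derivative `ν'' / ν'` of `ν'`. -/
def preSchwarzian (ν : ℂ → ℂ) (w : ℂ) : ℂ := deriv (deriv ν) w / deriv ν w

/-- The Schwarzian derivative of `ν`. -/
def schwarzian (ν : ℂ → ℂ) (w : ℂ) : ℂ :=
  deriv (preSchwarzian ν) w - preSchwarzian ν w ^ 2 / 2

lemma reducedForm_smul (c k m s r : ℂ) :
    c • reducedForm k m s r = reducedForm (k * c) (m * c) (s * c) (r * c) := by
  simp only [reducedForm, Matrix.fromBlocks_smul]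
  congr 1 <;> ext i j <;> fin_cases i <;> fin_cases j <;> simp <;> ring

namespace MovingFrame

variable {γ : ℂ → Q3} {w₀ : ℂ} {G : ℂ → Sp} {k m s r : ℂ → ℂ}

/-- Every reduced frame can be made normal. -/
lemma exists_normalFrame (h : MovingFrame γ w₀ G k m s r) :
    ∃ G' s' r', NormalFrame γ w₀ G' s' r' ∧
      ∀ᶠ w in 𝓝 w₀, r' w * normalScale ^ 3 = r w * m w ^ 3 := by
  obtain ⟨t, ht, ht0, hsq⟩ := exists_analytic_sqrt
    ((analyticAt_const (v := normalScale)).div h.analytic_m h.m_ne_zero)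
    (div_ne_zero normalScale_ne_zero h.m_ne_zero)
  obtain ⟨G₁, h₁⟩ := h.gauge_torus ht ht0
  have hm : ∀ᶠ w in 𝓝 w₀, m w * t w ^ 2 = normalScale := by
    filter_upwards [h.analytic_m.continuousAt.eventually_ne h.m_ne_zero] with w hw
    rw [hsq, Pi.div_apply, mul_div_cancel₀ _ hw]
  have h₁' := h₁.congr_data (k' := fun w => k w + deriv t w / t w) (m' := fun _ => normalScale)
    EventuallyEq.rfl (hm.mono fun w hw => hw.symm) EventuallyEq.rfl EventuallyEq.rfl
  -- the choice `u = 4 k / m` makes `k - m u / 4` vanish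
  obtain ⟨G₂, h₂⟩ := h₁'.gauge_unipotent (u := fun w => 4 / normalScale * (k w + deriv t w / t w))
    (analyticAt_const.mul h₁'.analytic_k)
  refine ⟨G₂, _, _, h₂.congr_data (Eventually.of_forall fun w => ?_) EventuallyEq.rfl
    EventuallyEq.rfl EventuallyEq.rfl, ?_⟩
  · field_simp [normalScale_ne_zero]
    simp
  · filter_upwards [hm, ht.continuousAt.eventually_ne ht0] with w hw h0
    rw [← hw]
    field_simp

/-- Pull-back by a holomorphic change of coordinate. -/
lemma comp {ν : ℂ → ℂ} {y₀ : ℂ} (h : MovingFrame γ (ν y₀) G k m s r) (hν : AnalyticAt ℂ ν y₀)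
    (hν0 : deriv ν y₀ ≠ 0) : MovingFrame (fun y => γ (ν y)) y₀ (fun y => G (ν y))
      (fun y => k (ν y) * deriv ν y) (fun y => m (ν y) * deriv ν y)
      (fun y => s (ν y) * deriv ν y) (fun y => r (ν y) * deriv ν y) := by
  have ht : Tendsto ν (𝓝 y₀) (𝓝 (ν y₀)) := hν.continuousAt
  refine ⟨(h.analytic_k.comp hν).mul hν.deriv, (h.analytic_m.comp hν).mul hν.deriv,
    (h.analytic_s.comp hν).mul hν.deriv, (h.analytic_r.comp hν).mul hν.deriv,
    mul_ne_zero h.m_ne_zero hν0, ht.eventually h.spans, ?_⟩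
  filter_upwards [ht.eventually h.hasDeriv, hν.eventually_analyticAt] with y hy hy2
  have := hy.comp_scalar hy2.differentiableAt.hasDerivAt
  rwa [← Matrix.mul_smul, reducedForm_smul] at this

/-- Under a change of coordinate the invariant `s` of a normal frame transforms like a projective
connection, by a multiple of the Schwarzian derivative, and `r` like a quartic differential. -/
lemma normal_comp {ν : ℂ → ℂ} {y₀ : ℂ} (h : NormalFrame γ (ν y₀) G s r) (hν : AnalyticAt ℂ ν y₀)
    (hν0 : deriv ν y₀ ≠ 0) : ∃ G', NormalFrame (fun y => γ (ν y)) y₀ G'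
      (fun y => s (ν y) * deriv ν y ^ 2 - 2 / normalScale * schwarzian ν y)
      (fun y => r (ν y) * deriv ν y ^ 4) := by
  have h₀ := MovingFrame.comp h hν hν0
  -- `t² = 1 / ν'` restores `m = normalScale`
  obtain ⟨t, ht, ht0, hsq⟩ := exists_analytic_sqrt (hν.deriv.inv hν0) (inv_ne_zero hν0)
  obtain ⟨G₁, h₁⟩ := h₀.gauge_torus ht ht0
  have hev : ∀ᶠ y in 𝓝 y₀, t y ≠ 0 ∧ deriv ν y ≠ 0 ∧ t y ^ 2 = (deriv ν y)⁻¹ ∧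
      deriv t y / t y = - preSchwarzian ν y / 2 := by
    filter_upwards [ht.continuousAt.eventually_ne ht0, hν.deriv.continuousAt.eventually_ne hν0,
      ht.eventually_analyticAt, hν.deriv.eventually_analyticAt] with y h1 h2 h3 h4
    refine ⟨h1, h2, hsq y, ?_⟩
    have e1 := h3.differentiableAt.hasDerivAt.fun_pow 2
    have e2 := h4.differentiableAt.hasDerivAt.fun_inv h2
    have e3 : (fun y => t y ^ 2) = fun y => (deriv ν y)⁻¹ := funext hsq
    rw [e3] at e1
    have e4 := e1.unique e2
    have e5 := hsq y
    rw [Pi.inv_apply] at e5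
    have e6 : deriv ν y = (t y ^ 2)⁻¹ := by rw [e5, inv_inv]
    rw [preSchwarzian]
    rw [e6] at e4 ⊢
    field_simp at e4 ⊢
    push_cast at e4
    apply mul_left_cancel₀ h1
    linear_combination e4
  have h₁' := h₁.congr_data (k' := fun y => - preSchwarzian ν y / 2)
    (m' := fun _ => normalScale) (s' := fun y => s (ν y) * deriv ν y ^ 2)
    (r' := fun y => r (ν y) * deriv ν y ^ 4)
    (hev.mono fun y ⟨h1, h2, h3, h4⟩ => by simp [h4])
    (hev.mono fun y ⟨h1, h2, h3, h4⟩ => by simp only [h3]; field_simp)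
    (hev.mono fun y ⟨h1, h2, h3, h4⟩ => by simp only [h3]; field_simp)
    (hev.mono fun y ⟨h1, h2, h3, h4⟩ => by
      simp only [show t y ^ 6 = (t y ^ 2) ^ 3 by ring, h3]; field_simp)
  have hl : AnalyticAt ℂ (preSchwarzian ν) y₀ := hν.deriv.deriv.div hν.deriv hν0
  obtain ⟨G₂, h₂⟩ := h₁'.gauge_unipotent (u := fun y => -2 / normalScale * preSchwarzian ν y)
    (analyticAt_const.mul hl)
  have hn := normalScale_ne_zero
  refine ⟨G₂, h₂.congr_data (Eventually.of_forall fun y => ?_) EventuallyEq.rfl ?_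
    EventuallyEq.rfl⟩
  · field_simp
    ring
  · filter_upwards [hl.eventually_analyticAt] with y hy
    rw [schwarzian, deriv_const_mul _ hy.differentiableAt]
    field_simp
    ring

end MovingFrame

/-! ### Uniqueness of normal frames and congruence of curves -/

/-- A locally constant function has vanishing derivative, nearby as well. -/
lemma eventually_deriv_eq_zero {f f' : ℂ → ℂ} {w₀ c : ℂ} (h : ∀ᶠ w in 𝓝 w₀, f w = c)
    (hd : ∀ᶠ w in 𝓝 w₀, HasDerivAt f (f' w) w) : ∀ᶠ w in 𝓝 w₀, f' w = 0 := by
  filter_upwards [eventually_eventually_nhds.2 h, hd] with w h1 h2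
  exact h2.unique ((hasDerivAt_const w c).congr_of_eventuallyEq h1)

lemma eventually_eq_of_hasDerivAt_zero {f : ℂ → ℂ} {w₀ : ℂ}
    (h : ∀ᶠ w in 𝓝 w₀, HasDerivAt f 0 w) : ∀ᶠ w in 𝓝 w₀, f w = f w₀ := by
  obtain ⟨ε, hε, hball⟩ := Metric.eventually_nhds_iff_ball.1 h
  filter_upwards [Metric.ball_mem_nhds w₀ hε] with w hw
  exact Metric.isOpen_ball.is_const_of_deriv_eq_zero (convex_ball w₀ ε).isPreconnected
    (fun z hz => (hball z hz).differentiableAt.differentiableWithinAt)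
    (fun z hz => (hball z hz).deriv) hw (Metric.mem_ball_self hε)

/-- Normal frames are unique up to sign, so that `s` and `r` are determined by the curve and the
coordinate. -/
lemma NormalFrame.unique {γ : ℂ → Q3} {w₀ : ℂ} {G G' : ℂ → Sp} {s r s' r' : ℂ → ℂ}
    (h : NormalFrame γ w₀ G s r) (h' : NormalFrame γ w₀ G' s' r') :
    s =ᶠ[𝓝 w₀] s' ∧ r =ᶠ[𝓝 w₀] r' := by
  set n := normalScale with hn
  have hn0 : n ≠ 0 := normalScale_ne_zero
  let g : ℂ → Matrix Idx Idx ℂ := fun w => (G w).1⁻¹ * (G' w).1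
  have hC : ∀ᶠ w in 𝓝 w₀, ∀ i j, g w (Sum.inr i) (Sum.inl j) = 0 := by
    filter_upwards [h.spans, h'.spans] with w h1 h2
    exact (frameSpan_eq_iff _ _).1 (h2.symm.trans h1)
  have hgd : ∀ᶠ w in 𝓝 w₀, HasMatrixDerivAt g (g w * reducedForm 0 n (s' w) (r' w) -
      reducedForm 0 n (s w) (r w) * g w) w := by
    filter_upwards [h.hasDeriv, h'.hasDeriv] with w h1 h2
    have := h1.inv.mul h2
    rw [← Matrix.mul_assoc, Matrix.neg_mul, Matrix.mul_assoc _ _ (G' w).1, neg_add_eq_sub] at this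
    exact this
  -- an entry which is constant near `w₀` has vanishing derivative
  have key : ∀ i j c, (∀ᶠ w in 𝓝 w₀, g w i j = c) → ∀ᶠ w in 𝓝 w₀,
      (g w * reducedForm 0 n (s' w) (r' w) - reducedForm 0 n (s w) (r w) * g w) i j = 0 :=
    fun i j c h => eventually_deriv_eq_zero h (hgd.mono fun w hw => hw i j)
  simp only [Matrix.sub_apply, Matrix.mul_apply, Fintype.sum_sum_type, Fin.sum_univ_two] at key
  have kC : ∀ i j, ∀ᶠ w in 𝓝 w₀, g w (Sum.inr i) (Sum.inl j) = 0 :=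
    fun i j => hC.mono fun w hw => hw i j
  have hgs : ∀ w, g w ∈ Matrix.symplecticGroup (Fin 2) ℂ := fun w => by
    have := ((G w)⁻¹ * G' w).2
    rwa [Submonoid.coe_mul, SymplecticGroup.coe_inv'] at this
  have hPD : ∀ᶠ w in 𝓝 w₀, ∀ i j, g w ix₁ (Sum.inl i) * g w ix₃ (Sum.inr j) +
      g w ix₂ (Sum.inl i) * g w ix₄ (Sum.inr j) = if i = j then 1 else 0 := by
    filter_upwards [hC] with w hw i j
    have h1 := congrFun (congrFun (SymplecticGroup.mem_iff'.1 (hgs w)) (Sum.inl i)) (Sum.inr j)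
    simp only [Matrix.mul_apply, Fintype.sum_sum_type, Fin.sum_univ_two, Matrix.J,
      Matrix.transpose_apply, Matrix.fromBlocks_apply₁₁, Matrix.fromBlocks_apply₁₂,
      Matrix.fromBlocks_apply₂₁, Matrix.fromBlocks_apply₂₂, Matrix.zero_apply, Matrix.neg_apply,
      Matrix.one_apply, hw] at h1
    fin_cases i <;> fin_cases j <;> simp at h1 ⊢ <;> linear_combination -h1
  -- Starting from the vanishing of the lower left block of `g`, each relation between entries is
  -- differentiated along `g' = g M' - M g` to give the next ones, until `g` is `1` or `-1`.
  have h₁ : ∀ᶠ w in 𝓝 w₀, g w ix₂ ix₁ = 0 ∧ g w ix₃ ix₄ = 0 ∧ g w ix₄ ix₄ = g w ix₂ ix₂ ∧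
      g w ix₂ ix₂ ^ 2 = 1 := by
    filter_upwards [key _ _ _ (kC 0 1), key _ _ _ (kC 1 0), key _ _ _ (kC 1 1), hPD, hC]
      with w h1 h2 h3 h4 h5
    simp [reducedForm, h5, hn0] at h1 h2 h3
    have h3' : g w ix₄ ix₄ = g w ix₂ ix₂ := mul_left_cancel₀ hn0 (by linear_combination h3)
    have h4' := h4 1 1
    simp only [h1, h3', mul_zero, zero_add, if_true] at h4'
    exact ⟨h2, h1, h3', by rw [sq]; exact h4'⟩
  have h₂ : ∀ᶠ w in 𝓝 w₀, g w ix₁ ix₁ = g w ix₂ ix₂ ∧ g w ix₂ ix₄ = g w ix₁ ix₂ := by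
    have hsq := eventually_deriv_eq_zero (h₁.mono fun w hw => hw.2.2.2)
      (hgd.mono fun w hw => (hw ix₂ ix₂).fun_pow 2)
    simp only [Matrix.sub_apply, Matrix.mul_apply, Fintype.sum_sum_type, Fin.sum_univ_two] at hsq
    filter_upwards [hsq, key _ _ _ (h₁.mono fun w hw => hw.1), h₁, hC] with w h1 h2 h3 h4
    have h0 : g w ix₂ ix₂ ≠ 0 := fun h => by simpa [h] using h3.2.2.2
    simp [reducedForm, h3.1, h4, h0] at h1 h2
    exact ⟨mul_left_cancel₀ hn0 (by linear_combination -h2),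
      mul_left_cancel₀ hn0 (by linear_combination h1)⟩
  have h₃ : ∀ᶠ w in 𝓝 w₀, g w ix₁ ix₂ = 0 ∧ g w ix₄ ix₃ = 0 ∧ g w ix₃ ix₃ = g w ix₂ ix₂ := by
    have hsq := eventually_deriv_eq_zero (c := 1) (h₁.and h₂ |>.mono fun w hw => by
      rw [hw.2.1]; exact hw.1.2.2.2) (hgd.mono fun w hw => (hw ix₁ ix₁).fun_pow 2)
    simp only [Matrix.sub_apply, Matrix.mul_apply, Fintype.sum_sum_type, Fin.sum_univ_two] at hsq
    filter_upwards [hsq, h₁, h₂, hC, hPD] with w h1 h2 h3 h4 h5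
    have h0 : g w ix₂ ix₂ ≠ 0 := fun h => by simpa [h] using h2.2.2.2
    simp [reducedForm, h2.1, h4, h0, h3.1, hn0] at h1
    have h6 := h5 0 0
    have h7 := h5 1 0
    simp [h1, h2.1, h3.1, h0] at h6 h7
    refine ⟨h1, h7, mul_left_cancel₀ h0 ?_⟩
    rw [h6, ← h2.2.2.2, sq]
  have h₄ : ∀ᶠ w in 𝓝 w₀, s w = s' w ∧ g w ix₁ ix₄ = 0 ∧ g w ix₂ ix₃ = 0 := by
    filter_upwards [key _ _ _ (h₃.mono fun w hw => hw.1), key _ _ _ (h₃.mono fun w hw => hw.2.1),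
      key ix₂ ix₄ 0 ((h₂.and h₃).mono fun w hw => by rw [hw.1.2, hw.2.1]), h₁, h₂, h₃, hC]
      with w h1 h2 h3 h4 h5 h6 h7
    have h0 : g w ix₂ ix₂ ≠ 0 := fun h => by simpa [h] using h4.2.2.2
    simp [reducedForm, h4.1, h4.2.1, h4.2.2.1, h5.1, h5.2, h6.1, h6.2.1, h6.2.2, h7] at h1 h2 h3
    -- the three relations force `5 (s - s') = 0`
    have e : s w = s' w := mul_left_cancel₀ h0 (by linear_combination (2 / 5) * (h2 - h1 - h3))
    rw [e] at h1 h2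
    exact ⟨e, mul_left_cancel₀ hn0 (by linear_combination h1),
      mul_left_cancel₀ hn0 (by linear_combination -h2)⟩
  have h₅ : ∀ᶠ w in 𝓝 w₀, g w ix₁ ix₃ = 0 := by
    filter_upwards [key _ _ _ (h₄.mono fun w hw => hw.2.2), h₁, h₂, h₃] with w h1 h2 h3 h4
    simpa [reducedForm, h2.1, h3.2, h4.1, h4.2.1, hn0] using h1
  refine ⟨h₄.mono fun w hw => hw.1, ?_⟩
  filter_upwards [key _ _ _ h₅, h₁, h₂, h₃, h₄] with w h1 h2 h3 h4 h5
  have h0 : g w ix₂ ix₂ ≠ 0 := fun h => by simpa [h] using h2.2.2.2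
  simp [reducedForm, h3.1, h4.2.2, h5.2.1, h5.2.2] at h1
  exact mul_left_cancel₀ h0 (by linear_combination -h1)

/-- Curves whose normal frames have the same invariants are congruent: `G' G⁻¹` is constant. -/
lemma NormalFrame.congruent {γ γ' : ℂ → Q3} {w₀ : ℂ} {G G' : ℂ → Sp} {s r : ℂ → ℂ}
    (h : NormalFrame γ w₀ G s r) (h' : NormalFrame γ' w₀ G' s r) :
    ∃ X : Sp, ∀ᶠ w in 𝓝 w₀, γ' w = X • γ w := by
  have hd : ∀ᶠ w in 𝓝 w₀, HasMatrixDerivAt (fun z => (G' z).1 * (G z).1⁻¹) 0 w := by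
    filter_upwards [h.hasDeriv, h'.hasDeriv] with w h1 h2
    have := h2.mul h1.inv
    rwa [Matrix.mul_neg, ← Matrix.mul_assoc, add_neg_cancel] at this
  have hconst : ∀ᶠ w in 𝓝 w₀, ∀ i j,
      ((G' w).1 * (G w).1⁻¹) i j = ((G' w₀).1 * (G w₀).1⁻¹) i j :=
    eventually_all.2 fun i => eventually_all.2 fun j =>
      eventually_eq_of_hasDerivAt_zero (hd.mono fun w hw => hw i j)
  refine ⟨G' w₀ * (G w₀)⁻¹, ?_⟩
  filter_upwards [h.spans, h'.spans, hconst] with w h1 h2 h3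
  have e : G' w = G' w₀ * (G w₀)⁻¹ * G w := by
    apply Subtype.ext
    rw [Submonoid.coe_mul, Submonoid.coe_mul, SymplecticGroup.coe_inv', ← Matrix.ext h3,
      Matrix.mul_assoc, (G w).inv_mul, Matrix.mul_one]
  apply Subtype.ext
  rw [h2, e, ← map_frameSpan, ← h1, smul_val]

/-! ### Holomorphic functions with prescribed Schwarzian derivative -/

/-- The coefficients of the power series solution of `u'' + q u = 0`, `u = 1 + O(w²)`, where `q` has
the coefficients `a n`. -/
def secondOrderCoeff (a : ℕ → ℂ) : ℕ → ℂ
  | 0 => 1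
  | 1 => 0
  | n + 2 => -(∑ i : Fin (n + 1), a i * secondOrderCoeff a (n - i)) / ((n + 1) * (n + 2))

lemma norm_secondOrderCoeff_le {a : ℕ → ℂ} {C ρ R : ℝ} (ha : ∀ n, ‖a n‖ ≤ C * ρ ^ n)
    (hρ : 0 ≤ ρ) (hR1 : 1 ≤ R) (hR : ρ ≤ R) (hC : C ≤ R) (hC0 : 0 ≤ C) (n : ℕ) :
    ‖secondOrderCoeff a n‖ ≤ R ^ n := by
  induction n using Nat.strong_induction_on with
  | _ n ih =>
    match n with
    | 0 => simp [secondOrderCoeff]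
    | 1 => simp [secondOrderCoeff]; linarith
    | n + 2 =>
      rw [secondOrderCoeff, norm_div, norm_neg]
      have h1 : ‖((n : ℂ) + 1) * (n + 2)‖ = ((n : ℝ) + 1) * (n + 2) := by
        have : ((n : ℂ) + 1) * (n + 2) = ((((n : ℝ) + 1) * (n + 2) : ℝ) : ℂ) := by push_cast; ring
        rw [this, Complex.norm_real, Real.norm_of_nonneg (by positivity)]
      rw [h1, div_le_iff₀ (by positivity)]
      calc ‖∑ i : Fin (n + 1), a i * secondOrderCoeff a (n - i)‖
          ≤ ∑ i : Fin (n + 1), C * R ^ n := by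
            refine norm_sum_le_of_le _ fun i _ => ?_
            rw [norm_mul]
            calc ‖a i‖ * ‖secondOrderCoeff a (n - i)‖ ≤ (C * R ^ (i : ℕ)) * R ^ (n - i) := by
                  refine mul_le_mul ((ha i).trans ?_) (ih _ (by omega)) (norm_nonneg _)
                    (by positivity)
                  gcongr
              _ = C * R ^ n := by
                  rw [mul_assoc, ← pow_add, Nat.add_sub_cancel' (by omega)]
        _ = ((n : ℝ) + 1) * (C * R ^ n) := by simp
        _ ≤ R ^ (n + 2) * ((n + 1) * (n + 2)) := by
            have h2 : C ≤ R ^ 2 * (n + 2) := by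
              have : (0 : ℝ) ≤ n := n.cast_nonneg
              nlinarith
            have h3 : 0 ≤ ((n : ℝ) + 1) * R ^ n := by positivity
            calc ((n : ℝ) + 1) * (C * R ^ n) = ((n + 1) * R ^ n) * C := by ring
              _ ≤ ((n + 1) * R ^ n) * (R ^ 2 * (n + 2)) := by gcongr
              _ = _ := by ring

/-- The equation `u'' + q u = 0` with holomorphic `q` has a holomorphic solution with `u(w₀) = 1`. -/
lemma exists_solution_second_order {q : ℂ → ℂ} {w₀ : ℂ} (hq : AnalyticAt ℂ q w₀) :
    ∃ u : ℂ → ℂ, AnalyticAt ℂ u w₀ ∧ u w₀ = 1 ∧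
      ∀ᶠ w in 𝓝 w₀, deriv (deriv u) w = -(q w * u w) := by
  set a : ℕ → ℂ := fun n => iteratedDeriv n q w₀ / n.factorial with ha
  obtain ⟨C, ρ, hC, hρ, hb⟩ := FormalMultilinearSeries.le_mul_pow_of_radius_pos _
    hq.hasFPowerSeriesAt.radius_pos
  have hb' : ∀ n, ‖a n‖ ≤ C * ρ ^ n := fun n => by
    have := hb n
    rwa [FormalMultilinearSeries.ofScalars_norm] at this
  -- `R` dominates both the growth rate `ρ` of the coefficients of `q` and the constant `C`
  set R : ℝ := max 1 (max ρ C) with hR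
  have hR1 : 1 ≤ R := le_max_left _ _
  have hc := norm_secondOrderCoeff_le hb' hρ.le hR1
    ((le_max_left _ _).trans (le_max_right _ _)) ((le_max_right _ _).trans (le_max_right _ _)) hC.le
  set c := secondOrderCoeff a with hcdef
  set p := FormalMultilinearSeries.ofScalars ℂ c with hp
  have hrad : 0 < p.radius := by
    have hR0 : 0 < R := by linarith
    have : (Real.toNNReal R⁻¹ : ENNReal) ≤ p.radius := by
      refine p.le_radius_of_bound 1 fun n => ?_
      rw [FormalMultilinearSeries.ofScalars_norm]
      rw [Real.coe_toNNReal _ (by positivity), inv_pow, ← div_eq_mul_inv, div_le_one (by positivity)]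
      exact hc n
    refine lt_of_lt_of_le ?_ this
    rw [ENNReal.coe_pos, Real.toNNReal_pos]
    positivity
  let u : ℂ → ℂ := fun w => p.sum (w - w₀)
  have hu : HasFPowerSeriesAt u p w₀ := by
    have := (p.hasFPowerSeriesOnBall hrad).comp_sub w₀
    rw [zero_add] at this
    exact this.hasFPowerSeriesAt
  have hua := hu.analyticAt
  have hder : ∀ n, iteratedDeriv n u w₀ = n.factorial * c n := fun n => by
    have h1 := FormalMultilinearSeries.ofScalars_series_injective ℂ ℂ
      (hua.hasFPowerSeriesAt.eq_formalMultilinearSeries hu)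
    have h2 := congrFun h1 n
    rw [← h2, mul_div_cancel₀ _ (Nat.cast_ne_zero.2 n.factorial_ne_zero)]
  refine ⟨u, hua, ?_, ?_⟩
  · simpa [c, secondOrderCoeff] using hder 0
  · have hv : AnalyticAt ℂ (deriv (deriv u) + q * u) w₀ := hua.deriv.deriv.add (hq.mul hua)
    have h0 : ∀ n, iteratedDeriv n (deriv (deriv u) + q * u) w₀ = 0 := fun n => by
      rw [iteratedDeriv_add hua.deriv.deriv.contDiffAt (hq.mul hua).contDiffAt,
        iteratedDeriv_mul hq.contDiffAt hua.contDiffAt, ← iteratedDeriv_succ',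
        ← iteratedDeriv_succ', hder, hcdef, secondOrderCoeff,
        Finset.sum_range]
      have e : ∀ i : Fin (n + 1), (n.choose i : ℂ) * iteratedDeriv i q w₀ *
          iteratedDeriv (n - i) u w₀ = n.factorial * (a i * secondOrderCoeff a (n - i)) := by
        intro i
        rw [hder, ha, Nat.cast_choose ℂ (by omega : (i : ℕ) ≤ n)]
        have := Nat.factorial_ne_zero (i : ℕ)
        have := Nat.factorial_ne_zero (n - i)
        field_simp
        rfl
      rw [Finset.sum_congr rfl fun i _ => e i, ← Finset.mul_sum, Nat.factorial_succ,
        Nat.factorial_succ]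
      have h1 : (n : ℂ) + 1 ≠ 0 := by exact_mod_cast Nat.succ_ne_zero n
      have h2 : (n : ℂ) + 2 ≠ 0 := by exact_mod_cast Nat.succ_ne_zero (n + 1)
      push_cast
      field_simp
      ring
    have hz := hv.hasFPowerSeriesAt
    simp only [h0, zero_div] at hz
    have hp0 : FormalMultilinearSeries.ofScalars ℂ (fun _ : ℕ => (0 : ℂ)) = 0 := by
      ext n
      simp [FormalMultilinearSeries.ofScalars]
    rw [hp0] at hz
    filter_upwards [hz.eventually_eq_zero] with w hw
    exact eq_neg_of_add_eq_zero_left hw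

/-- Every holomorphic function is locally the Schwarzian derivative of a coordinate. -/
lemma exists_schwarzian_eq {Q : ℂ → ℂ} {w₀ : ℂ} (hQ : AnalyticAt ℂ Q w₀) :
    ∃ z : ℂ → ℂ, AnalyticAt ℂ z w₀ ∧ deriv z w₀ ≠ 0 ∧ ∀ᶠ w in 𝓝 w₀, schwarzian z w = Q w := by
  obtain ⟨u, hu, hu1, hode⟩ := exists_solution_second_order (hQ.div_const (c := 2))
  have hu0 : u w₀ ≠ 0 := by rw [hu1]; exact one_ne_zero
  have hev : ∀ᶠ w in 𝓝 w₀, AnalyticAt ℂ u w ∧ u w ≠ 0 :=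
    hu.eventually_analyticAt.and (hu.continuousAt.eventually_ne hu0)
  obtain ⟨ε, hε, hball⟩ := Metric.eventually_nhds_iff_ball.1 hev
  have hdiff : DifferentiableOn ℂ (fun w => (u w ^ 2)⁻¹) (Metric.ball w₀ ε) := fun w hw =>
    (((hball w hw).1.differentiableAt.pow 2).inv
      (pow_ne_zero _ (hball w hw).2)).differentiableWithinAt
  obtain ⟨z, hz⟩ := hdiff.isExactOn_ball
  have hmem := Metric.ball_mem_nhds w₀ hε
  have hza : AnalyticAt ℂ z w₀ := DifferentiableOn.analyticAt
    (fun w hw => (hz w hw).differentiableAt.differentiableWithinAt) hmem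
  have hz' : ∀ᶠ w in 𝓝 w₀, deriv z w = (u w ^ 2)⁻¹ := by
    filter_upwards [hmem] with w hw using (hz w hw).deriv
  refine ⟨z, hza, by rw [hz'.self_of_nhds, hu1]; norm_num, ?_⟩
  have hpre : ∀ᶠ w in 𝓝 w₀, preSchwarzian z w = -2 * (deriv u w / u w) := by
    filter_upwards [eventually_eventually_nhds.2 hz', hev] with w h1 h2
    have e : deriv (deriv z) w = deriv (fun w => (u w ^ 2)⁻¹) w := EventuallyEq.deriv_eq h1
    have d := (h2.1.differentiableAt.hasDerivAt.fun_pow 2).fun_inv (pow_ne_zero 2 h2.2)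
    have h0 := h2.2
    rw [preSchwarzian, e, d.deriv, h1.self_of_nhds]
    norm_num
    field_simp
  filter_upwards [eventually_eventually_nhds.2 hpre, hev, hode] with w h1 h2 h3
  have e : deriv (preSchwarzian z) w = deriv (fun w => -2 * (deriv u w / u w)) w :=
    EventuallyEq.deriv_eq h1
  have h0 := h2.2
  have d := (h2.1.deriv.differentiableAt.hasDerivAt.fun_div h2.1.differentiableAt.hasDerivAt
    h2.2).const_mul (-2)
  rw [schwarzian, e, d.deriv, h1.self_of_nhds, h3]
  field_simp
  ring

/-! ### Charts of a Riemann surface -/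

/-- A holomorphic function with nonzero derivative restricts to a biholomorphic map between open
sets, whose source can be taken as small as desired. -/
lemma exists_local_biholomorphism {F : ℂ → ℂ} {w₀ : ℂ} (hF : AnalyticAt ℂ F w₀)
    (hF0 : deriv F w₀ ≠ 0) {N : Set ℂ} (hN : N ∈ 𝓝 w₀) :
    ∃ e : OpenPartialHomeomorph ℂ ℂ, w₀ ∈ e.source ∧ e.source ⊆ N ∧ (∀ w, e w = F w) ∧
      (∀ w ∈ e.source, AnalyticAt ℂ e w) ∧ ∀ y ∈ e.target, AnalyticAt ℂ e.symm y := by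
  obtain ⟨V, hVsub, hVo, hV⟩ := mem_nhds_iff.1 (inter_mem hN
    (hF.eventually_analyticAt.and (hF.deriv.continuousAt.eventually_ne hF0)))
  have hs : HasStrictFDerivAt F
      ((ContinuousLinearEquiv.unitsEquivAut ℂ (Units.mk0 _ hF0) : ℂ ≃L[ℂ] ℂ) : ℂ →L[ℂ] ℂ) w₀ :=
    (hF.hasStrictDerivAt).hasStrictFDerivAt_equiv hF0
  let e₀ := hs.toOpenPartialHomeomorph F
  have he₀ : ∀ w, e₀ w = F w := fun w => rfl
  let e := e₀.restrOpen V hVo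
  have hes : e.source ⊆ V := fun w hw => hw.2
  have hcoe : ∀ w, e w = F w := fun w => rfl
  have hfun : (e : ℂ → ℂ) = F := funext hcoe
  refine ⟨e, ⟨hs.mem_toOpenPartialHomeomorph_source, hV⟩, fun w hw => (hVsub (hes hw)).1, hcoe,
    fun w hw => ?_, fun y hy => ?_⟩
  · rw [hfun]
    exact (hVsub (hes hw)).2.1
  · have hw := hVsub (hes (e.map_target hy))
    have := e.contDiffAt_symm_deriv (n := ω) hw.2.2 hy
      (by rw [hfun]; exact hw.2.1.differentiableAt.hasDerivAt)
      (by rw [hfun]; exact hw.2.1.contDiffAt)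
    exact this.analyticAt

section TopologicalCharts

variable {S : Type*} [TopologicalSpace S]

lemma deriv_chart_symm {χ : OpenPartialHomeomorph S ℂ} {w : ℂ} (hw : w ∈ χ.target) :
    deriv (χ ∘ χ.symm) w = 1 := by
  have : χ ∘ χ.symm =ᶠ[𝓝 w] id := by
    filter_upwards [χ.open_target.mem_nhds hw] with z hz using χ.right_inv hz
  rw [this.deriv_eq, deriv_id]

lemma tendsto_symm_punctured (χ : OpenPartialHomeomorph S ℂ) {w : ℂ} (hw : w ∈ χ.target) :
    Tendsto χ.symm (𝓝[≠] w) (𝓝[≠] (χ.symm w)) := by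
  refine tendsto_nhdsWithin_iff.2 ⟨(χ.continuousAt_symm hw).tendsto.mono_left nhdsWithin_le_nhds, ?_⟩
  filter_upwards [self_mem_nhdsWithin, nhdsWithin_le_nhds (χ.open_target.mem_nhds hw)] with z h1 h2 h3
  exact h1 (χ.symm.injOn h2 hw h3)

lemma eventually_codiscrete_iff {P : S → Prop} :
    (∀ᶠ p in codiscrete S, P p) ↔ ∀ p, ∀ᶠ q in 𝓝[≠] p, P q := by
  simp only [Filter.Eventually, mem_codiscrete, disjoint_principal_right, compl_compl]

end TopologicalCharts

section Charts

variable {S : Type*} [TopologicalSpace S] [ChartedSpace ℂ S]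
variable {S' : Type*} [TopologicalSpace S'] [ChartedSpace ℂ S']

/-- The holomorphic charts of `S`. -/
abbrev HolChart (χ : OpenPartialHomeomorph S ℂ) : Prop := χ ∈ IsManifold.maximalAtlas 𝓘(ℂ) ω S

lemma HolChart.trans [IsManifold 𝓘(ℂ) ω S] {χ : OpenPartialHomeomorph S ℂ} (hχ : HolChart χ)
    (e : OpenPartialHomeomorph ℂ ℂ) (he : ∀ w ∈ e.source, AnalyticAt ℂ e w)
    (he' : ∀ y ∈ e.target, AnalyticAt ℂ e.symm y) : HolChart (χ ≫ₕ e) := by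
  refine OpenPartialHomeomorph.mem_maximalAtlas_of_contMDiffOn _ ?_ ?_
  · intro p hp
    rw [OpenPartialHomeomorph.trans_source] at hp
    exact (((he _ hp.2).contDiffAt.contMDiffAt).comp p
      (contMDiffAt_of_mem_maximalAtlas hχ hp.1)).contMDiffWithinAt
  · intro w hw
    rw [OpenPartialHomeomorph.trans_target] at hw
    exact ((contMDiffAt_symm_of_mem_maximalAtlas hχ hw.2).comp w
      ((he' _ hw.1).contDiffAt.contMDiffAt)).contMDiffWithinAt

lemma HolChart.mdifferentiableAt {χ : OpenPartialHomeomorph S ℂ} (hχ : HolChart χ) {p : S}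
    (hp : p ∈ χ.source) : MDifferentiableAt 𝓘(ℂ) 𝓘(ℂ) χ p :=
  (contMDiffAt_of_mem_maximalAtlas hχ hp).mdifferentiableAt (by simp)

lemma HolChart.mdifferentiableAt_symm {χ : OpenPartialHomeomorph S ℂ} (hχ : HolChart χ) {w : ℂ}
    (hw : w ∈ χ.target) : MDifferentiableAt 𝓘(ℂ) 𝓘(ℂ) χ.symm w :=
  (contMDiffAt_symm_of_mem_maximalAtlas hχ hw).mdifferentiableAt (by simp)

lemma differentiableAt_of_mdifferentiableAt {F : ℂ → ℂ} {w : ℂ}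
    (h : MDifferentiableAt 𝓘(ℂ) 𝓘(ℂ) F w) : DifferentiableAt ℂ F w :=
  mdifferentiableAt_iff_differentiableAt.1 h

lemma analyticAt_of_eventually_mdifferentiableAt {F : ℂ → ℂ} {w : ℂ}
    (h : ∀ᶠ z in 𝓝 w, MDifferentiableAt 𝓘(ℂ) 𝓘(ℂ) F z) : AnalyticAt ℂ F w :=
  Complex.analyticAt_iff_eventually_differentiableAt.2
    (h.mono fun _ hz => differentiableAt_of_mdifferentiableAt hz)

/-- The velocity vector `dψ(∂/∂w)` at `w` of a parametrization `ψ`. -/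
def velocity (ψ : ℂ → S) (w : ℂ) : TangentSpace 𝓘(ℂ) (ψ w) := mfderiv 𝓘(ℂ) 𝓘(ℂ) ψ w (1 : ℂ)

lemma mfderiv_velocity {M : Type*} [TopologicalSpace M] [ChartedSpace ℂ M] {ψ : ℂ → S} {h : S → M}
    {w : ℂ} (hψ : MDifferentiableAt 𝓘(ℂ) 𝓘(ℂ) ψ w) (hh : MDifferentiableAt 𝓘(ℂ) 𝓘(ℂ) h (ψ w)) :
    mfderiv 𝓘(ℂ) 𝓘(ℂ) h (ψ w) (velocity ψ w) = velocity (h ∘ ψ) w := by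
  rw [velocity, velocity, mfderiv_comp w hh hψ]
  rfl

lemma velocity_eq_deriv (F : ℂ → ℂ) (w : ℂ) : (velocity F w : ℂ) = deriv F w := by
  rw [velocity, mfderiv_eq_fderiv]
  exact fderiv_apply_one_eq_deriv (𝕜 := ℂ) (f := F) (x := w)

lemma mfderiv_velocity_eq_deriv {ψ : ℂ → S} {a : S → ℂ} {w : ℂ}
    (hψ : MDifferentiableAt 𝓘(ℂ) 𝓘(ℂ) ψ w) (ha : MDifferentiableAt 𝓘(ℂ) 𝓘(ℂ) a (ψ w)) :
    mfderiv 𝓘(ℂ) 𝓘(ℂ) a (ψ w) (velocity ψ w) = deriv (a ∘ ψ) w :=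
  (mfderiv_velocity hψ ha).trans (velocity_eq_deriv _ w)

lemma Differential.val_velocity_congr {q : ℕ} (σ : Differential q S) {ψ ψ' : ℂ → S} {w : ℂ}
    (h : ψ =ᶠ[𝓝 w] ψ') : σ.val (ψ w) (velocity ψ w) = σ.val (ψ' w) (velocity ψ' w) := by
  have h1 : ψ w = ψ' w := h.eq_of_nhds
  have h2 : (velocity ψ w : ℂ) = (velocity ψ' w : ℂ) := by
    have := h.mfderiv_eq (I := 𝓘(ℂ)) (I' := 𝓘(ℂ))
    exact congrArg (fun L : ℂ →L[ℂ] ℂ => L 1) this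
  let F : S → ℂ → ℂ := σ.val
  change F (ψ w) (velocity ψ w) = F (ψ' w) (velocity ψ' w)
  rw [h1, h2]

lemma Differential.coeff_eq {q : ℕ} (σ : Differential q S) (χ : OpenPartialHomeomorph S ℂ) (w : ℂ) :
    σ.coeff χ w = σ.val (χ.symm w) (velocity χ.symm w) := rfl

lemma chartForm_velocity {χ : OpenPartialHomeomorph S ℂ} (hχ : HolChart χ) {ψ : ℂ → S} {w : ℂ}
    (hψ : MDifferentiableAt 𝓘(ℂ) 𝓘(ℂ) ψ w) (hw : ψ w ∈ χ.source) :
    chartForm χ (ψ w) (velocity ψ w) = deriv (χ ∘ ψ) w :=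
  mfderiv_velocity_eq_deriv hψ (hχ.mdifferentiableAt hw)

/-- The tangent line at `χ.symm w` is spanned by `∂/∂w`, and `dw` is the dual basis. -/
lemma eq_chartForm_smul {χ : OpenPartialHomeomorph S ℂ} (hχ : HolChart χ) {w : ℂ}
    (hw : w ∈ χ.target) (v : TangentSpace 𝓘(ℂ) (χ.symm w)) :
    v = chartForm χ (χ.symm w) v • velocity χ.symm w := by
  have h1 : chartForm χ (χ.symm w) (velocity χ.symm w) = 1 := by
    rw [chartForm_velocity hχ (hχ.mdifferentiableAt_symm hw) (χ.map_target hw),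
      deriv_chart_symm hw]
  let L : ℂ →L[ℂ] ℂ := mfderiv 𝓘(ℂ) 𝓘(ℂ) χ (χ.symm w)
  have hL : ∀ x : ℂ, L x = x * L 1 := fun x => by
    have := L.map_smul x 1
    rwa [smul_eq_mul, mul_one, smul_eq_mul] at this
  have h1' : L (velocity χ.symm w) = 1 := h1
  let x : ℂ := v
  let y : ℂ := velocity χ.symm w
  change L y = 1 at h1'
  change x = L x * y
  rw [hL] at h1' ⊢
  linear_combination (-x) * h1'

lemma eq_zero_of_chartForm_eq_zero {χ : OpenPartialHomeomorph S ℂ} (hχ : HolChart χ) {p : S}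
    (hp : p ∈ χ.source) {v : TangentSpace 𝓘(ℂ) p} (h : chartForm χ p v = 0) : v = 0 := by
  obtain ⟨w, hw, rfl⟩ : ∃ w ∈ χ.target, χ.symm w = p := ⟨χ p, χ.map_source hp, χ.left_inv hp⟩
  rw [eq_chartForm_smul hχ hw v, h]
  exact zero_smul ℂ _

lemma Differential.ext_at {q : ℕ} {σ τ : Differential q S} {χ : OpenPartialHomeomorph S ℂ}
    (hχ : HolChart χ) {w : ℂ} (hw : w ∈ χ.target) (h : σ.coeff χ w = τ.coeff χ w) :
    ∀ v, σ.val (χ.symm w) v = τ.val (χ.symm w) v := by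
  intro v
  rw [eq_chartForm_smul hχ hw v, σ.homogeneous, τ.homogeneous]
  exact congrArg _ h

lemma Differential.AEq.coeff_eventuallyEq {q : ℕ} {σ τ : Differential q S} (h : σ.AEq τ)
    {χ : OpenPartialHomeomorph S ℂ} {w : ℂ} (hw : w ∈ χ.target) :
    σ.coeff χ =ᶠ[𝓝[≠] w] τ.coeff χ :=
  ((tendsto_symm_punctured χ hw).eventually (eventually_codiscrete_iff.1 h (χ.symm w))).mono
    fun _ hz => hz _

/-- Around a noncritical point of `h`, the composition of `h` with a parametrization of `S'` is a
parametrization of `S`. -/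
lemma exists_chart_comp [IsManifold 𝓘(ℂ) ω S] {h : S' → S}
    (hh : MDifferentiable 𝓘(ℂ) 𝓘(ℂ) h) {χ : OpenPartialHomeomorph S' ℂ} (hχ : HolChart χ) {w₀ : ℂ}
    (hw₀ : w₀ ∈ χ.target) (hd : mfderiv 𝓘(ℂ) 𝓘(ℂ) h (χ.symm w₀) ≠ 0) :
    ∃ η : OpenPartialHomeomorph S ℂ, HolChart η ∧ w₀ ∈ η.target ∧ η.target ⊆ χ.target ∧
      ∀ w ∈ η.target, η.symm w = h (χ.symm w) := by
  let φ := chartAt ℂ (h (χ.symm w₀))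
  have hφ : HolChart φ := IsManifold.chart_mem_maximalAtlas _
  have hN : ∀ᶠ w in 𝓝 w₀, w ∈ χ.target ∧ h (χ.symm w) ∈ φ.source :=
    (show ∀ᶠ w in 𝓝 w₀, w ∈ χ.target from χ.open_target.mem_nhds hw₀).and ((hh.continuous.continuousAt.comp
      (χ.continuousAt_symm hw₀)).eventually (φ.open_source.mem_nhds (mem_chart_source _ _)))
  have hmd : ∀ w ∈ χ.target, MDifferentiableAt 𝓘(ℂ) 𝓘(ℂ) (h ∘ χ.symm) w := fun w hw =>
    (hh _).comp w (hχ.mdifferentiableAt_symm hw)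
  let F : ℂ → ℂ := φ ∘ (h ∘ χ.symm)
  have hF : AnalyticAt ℂ F w₀ := analyticAt_of_eventually_mdifferentiableAt
    (hN.mono fun w hw => (hφ.mdifferentiableAt hw.2).comp w (hmd w hw.1))
  have hF0 : deriv F w₀ ≠ 0 := by
    intro h0
    apply hd
    have h1 : chartForm φ _ (velocity (h ∘ χ.symm) w₀) = 0 :=
      (chartForm_velocity hφ (hmd _ hw₀) hN.self_of_nhds.2).trans h0
    have h2 := eq_zero_of_chartForm_eq_zero hφ hN.self_of_nhds.2 h1
    have h3 := (mfderiv_velocity (hχ.mdifferentiableAt_symm hw₀) (hh _)).trans h2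
    refine ContinuousLinearMap.ext fun v => ?_
    rw [eq_chartForm_smul hχ hw₀ v, map_smul, h3]
    exact smul_zero _
  obtain ⟨e, he0, heN, heF, hea, hes⟩ := exists_local_biholomorphism hF hF0 hN
  refine ⟨φ ≫ₕ e.symm, hφ.trans e.symm hes hea, ?_, ?_, ?_⟩
  · rw [OpenPartialHomeomorph.trans_target]
    refine ⟨he0, ?_⟩
    change e w₀ ∈ φ.target
    rw [heF]
    exact φ.map_source hN.self_of_nhds.2
  · intro w hw
    rw [OpenPartialHomeomorph.trans_target] at hw
    exact (heN hw.1).1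
  · intro w hw
    rw [OpenPartialHomeomorph.trans_target] at hw
    change φ.symm (e w) = _
    rw [heF]
    exact φ.left_inv (heN hw.1).2

end Charts

section Frames

variable {S : Type*} [TopologicalSpace S] [ChartedSpace ℂ S]

/-! ### Reduced frames on the surface and in a coordinate -/

lemma mcForm_velocity {A : S → Sp} {χ : OpenPartialHomeomorph S ℂ} (hχ : HolChart χ) {w : ℂ}
    (hw : w ∈ χ.target)
    (hA : ∀ i j, MDifferentiableAt 𝓘(ℂ) 𝓘(ℂ) (fun p => (A p).1 i j) (χ.symm w)) :
    mcForm A (χ.symm w) (velocity χ.symm w) =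
      (A (χ.symm w)).1⁻¹ * Matrix.of fun i j => deriv (fun z => (A (χ.symm z)).1 i j) w := by
  rw [mcForm]
  congr 1
  ext i j
  exact mfderiv_velocity_eq_deriv (hχ.mdifferentiableAt_symm hw) (hA i j)

/-- The Maurer-Cartan form of a symplectic frame has values in `𝔰𝔭(2, ℂ)`. -/
lemma transpose_mul_J_add_eq_zero {G : ℂ → Sp} {M : Matrix Idx Idx ℂ} {w : ℂ}
    (hG : HasMatrixDerivAt (fun z => (G z).1) ((G w).1 * M) w) :
    Mᵀ * J (Fin 2) ℂ + J (Fin 2) ℂ * M = 0 := by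
  have hT : HasMatrixDerivAt (fun z => (G z).1ᵀ) ((G w).1 * M)ᵀ w := fun i j => hG j i
  have h1 := (hT.mul ((HasMatrixDerivAt.const (J (Fin 2) ℂ) w).mul hG)).unique
    ((HasMatrixDerivAt.const (J (Fin 2) ℂ) w).congr_eventuallyEq
      (Eventually.of_forall fun z => by
        exact (Matrix.mul_assoc _ _ _).symm.trans (SymplecticGroup.mem_iff'.1 (G z).2)))
  have h2 := SymplecticGroup.mem_iff'.1 (G w).2
  rw [Matrix.zero_mul, zero_add, Matrix.transpose_mul] at h1
  rw [← h1]
  conv_lhs => rw [← h2]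
  simp only [Matrix.mul_assoc]

/-- An element of `𝔰𝔭(2, ℂ)` satisfying the linear equations of the reduced frame bundle. -/
lemma eq_reducedForm {M : Matrix Idx Idx ℂ} (hM : Mᵀ * J (Fin 2) ℂ + J (Fin 2) ℂ * M = 0)
    (h₁ : M ix₃ ix₁ = 0) (h₂ : M ix₄ ix₁ = 0) (h₃ : M ix₂ ix₁ - M ix₄ ix₂ = 0)
    (h₄ : M ix₁ ix₁ - 3 * M ix₂ ix₂ = 0) (h₅ : 4 * M ix₁ ix₂ - 3 * M ix₂ ix₄ = 0)
    (h₆ : M ix₁ ix₄ = 0) :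
    M = reducedForm (M ix₂ ix₂) (M ix₄ ix₂) (M ix₂ ix₄) (M ix₁ ix₃) := by
  have h : ∀ i j, (Mᵀ * J (Fin 2) ℂ + J (Fin 2) ℂ * M) i j = 0 := fun i j => by rw [hM]; rfl
  have a1 := h ix₁ ix₃
  have a2 := h ix₁ ix₄
  have a3 := h ix₂ ix₃
  have a4 := h ix₂ ix₄
  have a5 := h ix₁ ix₂
  have a6 := h ix₃ ix₄
  simp [Matrix.mul_apply, Fintype.sum_sum_type, Matrix.J, Matrix.one_apply]
    at a1 a2 a3 a4 a5 a6
  ext (i | i) (j | j) <;> fin_cases i <;> fin_cases j <;> simp [reducedForm]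
  · linear_combination h₄
  · linear_combination h₅ / 4
  · linear_combination h₃
  · exact h₆
  · linear_combination h₆ - a6
  · exact h₁
  · linear_combination h₂ - a5
  · exact h₂
  · linear_combination -a1 - h₄
  · linear_combination -a2 - h₃
  · linear_combination -a3 - h₅ / 4
  · linear_combination -a4

/-- A reduced frame on the surface is a moving frame in any coordinate. -/
lemma IsReducedFrame.movingFrame {f : S → Q3} {U : Set S} {A : S → Sp} (h : IsReducedFrame f U A)
    {χ : OpenPartialHomeomorph S ℂ} (hχ : HolChart χ) {w₀ : ℂ} (hw₀ : w₀ ∈ χ.target)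
    (hU : χ.symm w₀ ∈ U) : ∃ k m s r, MovingFrame (fun w => f (χ.symm w)) w₀
      (fun w => A (χ.symm w)) k m s r ∧ ∀ᶠ w in 𝓝 w₀,
        mcForm A (χ.symm w) (velocity χ.symm w) = reducedForm (k w) (m w) (s w) (r w) := by
  have hN : ∀ᶠ w in 𝓝 w₀, w ∈ χ.target ∧ χ.symm w ∈ U :=
    (show ∀ᶠ w in 𝓝 w₀, w ∈ χ.target from χ.open_target.mem_nhds hw₀).and
      ((χ.continuousAt_symm hw₀).eventually (h.isOpen.mem_nhds hU))
  have hmd : ∀ w, w ∈ χ.target ∧ χ.symm w ∈ U →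
      ∀ i j, MDifferentiableAt 𝓘(ℂ) 𝓘(ℂ) (fun p => (A p).1 i j) (χ.symm w) :=
    fun w hw i j => (h.holomorphic i j).mdifferentiableAt (h.isOpen.mem_nhds hw.2)
  let G : ℂ → Sp := fun w => A (χ.symm w)
  let M : ℂ → Matrix Idx Idx ℂ := fun w => mcForm A (χ.symm w) (velocity χ.symm w)
  have hG : ∀ w, w ∈ χ.target ∧ χ.symm w ∈ U → ∀ i j,
      DifferentiableAt ℂ (fun z => (G z).1 i j) w := fun w hw i j =>
    differentiableAt_of_mdifferentiableAt
      (MDifferentiableAt.comp (I' := 𝓘(ℂ)) w (hmd w hw i j) (hχ.mdifferentiableAt_symm hw.1))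
  have hGa : ∀ i j, AnalyticAt ℂ (fun z => (G z).1 i j) w₀ := fun i j =>
    Complex.analyticAt_iff_eventually_differentiableAt.2 (hN.mono fun w hw => hG w hw i j)
  have hMeq : ∀ w, w ∈ χ.target ∧ χ.symm w ∈ U → M w =
      (G w).1⁻¹ * Matrix.of fun i j => deriv (fun z => (G z).1 i j) w := fun w hw =>
    mcForm_velocity hχ hw.1 (hmd w hw)
  have hMa : ∀ i j, AnalyticAt ℂ (fun w => M w i j) w₀ := by
    intro i j
    have hinv : ∀ i j, AnalyticAt ℂ (fun w => (G w).1⁻¹ i j) w₀ := by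
      intro i j
      simp only [inv_eq_of_mem, Matrix.mul_apply, Matrix.transpose_apply]
      exact Finset.analyticAt_fun_sum _ fun k _ => (Finset.analyticAt_fun_sum _ fun l _ =>
        analyticAt_const.mul (hGa k l)).mul analyticAt_const
    have : AnalyticAt ℂ (fun w => ∑ k, (G w).1⁻¹ i k * deriv (fun z => (G z).1 k j) w) w₀ :=
      Finset.analyticAt_fun_sum _ fun k _ => (hinv i k).mul (hGa k j).deriv
    refine this.congr (hN.mono fun w hw => ?_)
    change _ = M w i j
    rw [hMeq w hw, Matrix.mul_apply]
    rfl
  have hGd : ∀ w, w ∈ χ.target ∧ χ.symm w ∈ U →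
      HasMatrixDerivAt (fun z => (G z).1) ((G w).1 * M w) w := by
    intro w hw i j
    rw [hMeq w hw, ← Matrix.mul_assoc, (G w).mul_inv, Matrix.one_mul]
    exact (hG w hw i j).hasDerivAt
  have hred : ∀ w, w ∈ χ.target ∧ χ.symm w ∈ U →
      M w = reducedForm (M w ix₂ ix₂) (M w ix₄ ix₂) (M w ix₂ ix₄) (M w ix₁ ix₃) := fun w hw =>
    eq_reducedForm (transpose_mul_J_add_eq_zero (hGd w hw)) (h.pfaff₁ _ hw.2 _) (h.pfaff₂ _ hw.2 _)
      (h.pfaff₃ _ hw.2 _) (h.pfaff₄ _ hw.2 _) (h.pfaff₅ _ hw.2 _) (h.pfaff₆ _ hw.2 _)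
  refine ⟨fun w => M w ix₂ ix₂, fun w => M w ix₄ ix₂, fun w => M w ix₂ ix₄, fun w => M w ix₁ ix₃,
    ⟨hMa _ _, hMa _ _, hMa _ _, hMa _ _, ?_, hN.mono fun w hw => h.spans _ hw.2,
      hN.mono fun w hw => ?_⟩, hN.mono fun w hw => hred w hw⟩
  · refine h.independence _ hU _ fun h0 => ?_
    have h1 := chartForm_velocity hχ (hχ.mdifferentiableAt_symm hw₀) (χ.map_target hw₀)
    rw [deriv_chart_symm hw₀, h0, chartForm, map_zero] at h1
    exact zero_ne_one (α := ℂ) h1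
  · have := hGd w hw
    rwa [hred w hw] at this

/-- Moving frames in a coordinate define reduced frames on the surface. -/
lemma MovingFrame.isReducedFrame {f : S → Q3} {U : Set S} {χ : OpenPartialHomeomorph S ℂ}
    (hχ : HolChart χ) (hUo : IsOpen U) (hU : U ⊆ χ.source) {G : ℂ → Sp} {k m s r : ℂ → ℂ}
    (h : ∀ p ∈ U, MovingFrame (fun w => f (χ.symm w)) (χ p) G k m s r) :
    IsReducedFrame f U (fun p => G (χ p)) ∧ ∀ p ∈ U, ∀ v, mcForm (fun p => G (χ p)) p v =
      chartForm χ p v • reducedForm (k (χ p)) (m (χ p)) (s (χ p)) (r (χ p)) := by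
  have hd : ∀ p ∈ U, HasMatrixDerivAt (fun z => (G z).1)
      ((G (χ p)).1 * reducedForm (k (χ p)) (m (χ p)) (s (χ p)) (r (χ p))) (χ p) :=
    fun p hp => (h p hp).hasDeriv.self_of_nhds
  have hmd : ∀ p ∈ U, ∀ i j, HasMFDerivAt 𝓘(ℂ) 𝓘(ℂ) (fun q => (G (χ q)).1 i j) p
      ((ContinuousLinearMap.toSpanSingleton ℂ (((G (χ p)).1 *
        reducedForm (k (χ p)) (m (χ p)) (s (χ p)) (r (χ p))) i j)).comp
        (mfderiv 𝓘(ℂ) 𝓘(ℂ) χ p)) := fun p hp i j =>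
    HasMFDerivAt.comp (g := fun z => (G z).1 i j) p (hd p hp i j).hasFDerivAt.hasMFDerivAt
      (hχ.mdifferentiableAt (hU hp)).hasMFDerivAt
  have hmc : ∀ p ∈ U, ∀ v, mcForm (fun p => G (χ p)) p v =
      chartForm χ p v • reducedForm (k (χ p)) (m (χ p)) (s (χ p)) (r (χ p)) := by
    intro p hp v
    rw [← Matrix.one_mul (reducedForm _ _ _ _), ← (G (χ p)).inv_mul, Matrix.mul_assoc,
      ← Matrix.mul_smul, mcForm]
    congr 1
    ext i j
    exact congrArg (fun L : ℂ →L[ℂ] ℂ => L v) (hmd p hp i j).mfderiv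
  refine ⟨⟨⟨hUo, fun i j p hp => (hmd p hp i j).mdifferentiableAt.mdifferentiableWithinAt,
    fun p hp => ?_⟩, ?_, ?_, ?_, ?_, ?_, ?_, ?_⟩, hmc⟩
  · have := (h p hp).spans.self_of_nhds
    rwa [χ.left_inv (hU hp)] at this
  all_goals intro p hp v
  pick_goal 7
  · intro hv
    rw [hmc p hp v]
    have h1 : chartForm χ p v ≠ 0 := fun h0 => hv (eq_zero_of_chartForm_eq_zero hχ (hU hp) h0)
    simpa [reducedForm, h1] using (h p hp).m_ne_zero
  all_goals
    rw [hmc p hp v]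
    simp [reducedForm]
  · ring
  · ring

/-- The existence of reduced frames in terms of normal frames in a coordinate. -/
lemma exists_isReducedFrame_iff {f : S → Q3} {χ : OpenPartialHomeomorph S ℂ} (hχ : HolChart χ)
    {w₀ : ℂ} (hw₀ : w₀ ∈ χ.target) :
    (∃ A : S → Sp, ∃ U : Set S, χ.symm w₀ ∈ U ∧ IsReducedFrame f U A) ↔
      ∃ G s r, NormalFrame (fun w => f (χ.symm w)) w₀ G s r := by
  constructor
  · rintro ⟨A, U, hU, h⟩
    obtain ⟨k, m, s, r, hF, -⟩ := h.movingFrame hχ hw₀ hU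
    obtain ⟨G, s', r', hG, -⟩ := hF.exists_normalFrame
    exact ⟨G, s', r', hG⟩
  · rintro ⟨G, s, r, hG⟩
    have hev : ∀ᶠ p in 𝓝 (χ.symm w₀), p ∈ χ.source ∧
        NormalFrame (fun w => f (χ.symm w)) (χ p) G s r := by
      have hs := χ.map_target hw₀
      refine (show ∀ᶠ p in 𝓝 (χ.symm w₀), p ∈ χ.source from χ.open_source.mem_nhds hs).and
        ((χ.continuousAt hs).eventually
          (p := fun w => NormalFrame (fun w => f (χ.symm w)) w G s r) ?_)
      rw [χ.right_inv hw₀]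
      exact hG.eventually
    obtain ⟨U, hUs, hUo, hU⟩ := mem_nhds_iff.1 hev
    exact ⟨_, U, hU, (MovingFrame.isReducedFrame hχ hUo (fun p hp => (hUs hp).1)
      fun p hp => (hUs hp).2).1⟩

/-! ### The quartic differential in a coordinate -/

lemma quarticDifferential_coeff {f : S → Q3} {χ : OpenPartialHomeomorph S ℂ} (hχ : HolChart χ)
    {w₀ : ℂ} (hw₀ : w₀ ∈ χ.target) {G : ℂ → Sp} {s r : ℂ → ℂ}
    (hG : NormalFrame (fun w => f (χ.symm w)) w₀ G s r) :
    (quarticDifferential f).coeff χ w₀ = r w₀ * normalScale ^ 3 := by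
  have hex := (exists_isReducedFrame_iff (f := f) hχ hw₀).2 ⟨G, s, r, hG⟩
  refine (dif_pos hex).trans ?_
  obtain ⟨U, hU, h⟩ := hex.choose_spec
  obtain ⟨k, m, s', r', hF, hmc⟩ := h.movingFrame hχ hw₀ hU
  obtain ⟨G', s'', r'', hN, hr⟩ := hF.exists_normalFrame
  have hmc' := hmc.self_of_nhds
  change mcForm _ (χ.symm w₀) (velocity χ.symm w₀) ix₁ ix₃ *
    mcForm _ (χ.symm w₀) (velocity χ.symm w₀) ix₄ ix₂ ^ 3 = _
  rw [hmc', (hG.unique hN).2.eq_of_nhds, hr.self_of_nhds]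
  simp [reducedForm]

lemma quarticDifferential_coeff_of_not_exists {f : S → Q3} {χ : OpenPartialHomeomorph S ℂ}
    (hχ : HolChart χ) {w₀ : ℂ} (hw₀ : w₀ ∈ χ.target)
    (hG : ¬ ∃ G s r, NormalFrame (fun w => f (χ.symm w)) w₀ G s r) :
    (quarticDifferential f).coeff χ w₀ = 0 :=
  dif_neg (mt (exists_isReducedFrame_iff hχ hw₀).1 hG)

lemma quarticDifferential_coeff_eventuallyEq {f : S → Q3} {χ : OpenPartialHomeomorph S ℂ}
    (hχ : HolChart χ) {w₀ : ℂ} (hw₀ : w₀ ∈ χ.target) {G : ℂ → Sp} {s r : ℂ → ℂ}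
    (hG : NormalFrame (fun w => f (χ.symm w)) w₀ G s r) :
    (quarticDifferential f).coeff χ =ᶠ[𝓝 w₀] fun w => r w * normalScale ^ 3 := by
  filter_upwards [hG.eventually, χ.open_target.mem_nhds hw₀] with w hw hwt
  exact quarticDifferential_coeff hχ hwt hw

end Frames

/-! ### The second order operator in a coordinate -/

/-- The function `Z''/(2 Z) - 9 Z'²/(16 Z²)`. -/
def coordOperator (Z : ℂ → ℂ) (w : ℂ) : ℂ :=
  1 / 2 * (deriv (deriv Z) w / Z w) - 9 / 16 * (deriv Z w ^ 2 / Z w ^ 2)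

lemma coordOperator_congr {Z Z' : ℂ → ℂ} {w : ℂ} (h : Z =ᶠ[𝓝 w] Z') :
    coordOperator Z w = coordOperator Z' w := by
  rw [coordOperator, coordOperator, h.eq_of_nhds, h.deriv_eq, h.deriv.deriv_eq]

/-- For a quartic differential `Z dz⁴`, the failure of `Z''/(2 Z) - 9 Z'²/(16 Z²)` to transform
like a quadratic differential is twice the Schwarzian derivative. -/
lemma coordOperator_comp {Z W ν : ℂ → ℂ} {w : ℂ} (hν : AnalyticAt ℂ ν w) (hν0 : deriv ν w ≠ 0)
    (hZ : AnalyticAt ℂ Z (ν w)) (hZ0 : Z (ν w) ≠ 0)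
    (hW : W =ᶠ[𝓝 w] fun y => Z (ν y) * deriv ν y ^ 4) :
    coordOperator W w = coordOperator Z (ν w) * deriv ν w ^ 2 + 2 * schwarzian ν w := by
  have hcomp : ∀ {F : ℂ → ℂ} {y : ℂ}, AnalyticAt ℂ ν y → AnalyticAt ℂ F (ν y) →
      HasDerivAt (fun y => F (ν y)) (deriv F (ν y) * deriv ν y) y := fun h1 h2 =>
    h2.differentiableAt.hasDerivAt.comp _ h1.differentiableAt.hasDerivAt
  have hd1 : deriv W =ᶠ[𝓝 w] fun y => deriv Z (ν y) * deriv ν y ^ 5 +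
      4 * (Z (ν y) * (deriv ν y ^ 3 * deriv (deriv ν) y)) := by
    filter_upwards [hW.eventuallyEq_nhds, hν.eventually_analyticAt,
      hν.continuousAt.eventually hZ.eventually_analyticAt] with y h1 h2 h3
    rw [h1.deriv_eq]
    refine (((hcomp h2 h3).mul (h2.deriv.differentiableAt.hasDerivAt.fun_pow 4)).congr_deriv
      ?_).deriv
    norm_num
    ring
  have hd2 := (((hcomp hν hZ.deriv).mul (hν.deriv.differentiableAt.hasDerivAt.fun_pow 5)).add
    (((hcomp hν hZ).mul ((hν.deriv.differentiableAt.hasDerivAt.fun_pow 3).mul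
      hν.deriv.deriv.differentiableAt.hasDerivAt)).const_mul 4)).deriv
  have hS : deriv (preSchwarzian ν) w = _ := (hν.deriv.deriv.differentiableAt.hasDerivAt.div
    hν.deriv.differentiableAt.hasDerivAt hν0).deriv
  have hd2' : deriv (deriv W) w = _ := hd1.deriv_eq.trans hd2
  rw [coordOperator, coordOperator, schwarzian, hS, hd2', hd1.eq_of_nhds, hW.eq_of_nhds,
    preSchwarzian]
  norm_num
  field_simp
  ring

section Operator

variable {S : Type*} [TopologicalSpace S] [ChartedSpace ℂ S]

/-- The flat frame of an adapted chart is a normal frame with `s = 0`. -/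
lemma IsAdaptedChart.exists_normalFrame {f : S → Q3} {z : OpenPartialHomeomorph S ℂ}
    (hz : IsAdaptedChart f z) {p : S} (hp : p ∈ z.source) :
    ∃ G r, NormalFrame (fun w => f (z.symm w)) (z p) G (fun _ => 0) r := by
  have hχ : HolChart z := hz.1
  obtain ⟨-, A, hA, hflat⟩ := hz
  have hw := z.map_source hp
  obtain ⟨k, m, s, r, hF, hmc⟩ := hA.movingFrame hχ hw (by rwa [z.left_inv hp])
  have hdata : ∀ᶠ w in 𝓝 (z p), 0 = k w ∧ normalScale = m w ∧ 0 = s w := by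
    filter_upwards [hmc, z.open_target.mem_nhds hw] with w h1 h2
    have h3 := hflat _ (z.map_target h2) (velocity z.symm w)
    rw [chartForm_velocity hχ (hχ.mdifferentiableAt_symm h2) (z.map_target h2),
      deriv_chart_symm h2, cartanForm, h1] at h3
    have e1 : k w = 0 := congrFun (congrFun h3 0) 0
    have e2 : -(((3 / 32 : ℝ) ^ (1 / 3 : ℝ) : ℝ) : ℂ) * s w = 0 := congrFun (congrFun h3 0) 1
    have e3 : -(((6 : ℝ) ^ (-(1 / 3) : ℝ) : ℝ) : ℂ) * m w = 1 := congrFun (congrFun h3 1) 0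
    refine ⟨e1.symm, ?_, ?_⟩
    · refine mul_left_cancel₀ (left_ne_zero_of_mul_eq_one e3) ?_
      rw [e3, neg_mul_normalScale]
    · refine ((mul_eq_zero.1 e2).resolve_left ?_).symm
      rw [← ne_eq, neg_ne_zero, Complex.ofReal_ne_zero]
      positivity
  exact ⟨_, r, hF.congr_data (hdata.mono fun w h => h.1) (hdata.mono fun w h => h.2.1)
    (hdata.mono fun w h => h.2.2) EventuallyEq.rfl⟩

/-- The pull-back of the operator in an adapted chart `z` to any coordinate. -/
lemma chartOperator_velocity {f : S → Q3} {z χ : OpenPartialHomeomorph S ℂ}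
    (hz : IsAdaptedChart f z) (hχ : HolChart χ) {w₀ : ℂ} (hw₀ : w₀ ∈ χ.target)
    (hp : χ.symm w₀ ∈ z.source) {G : ℂ → Sp} {s r : ℂ → ℂ}
    (hG : NormalFrame (fun w => f (χ.symm w)) w₀ G s r) (hr : r w₀ ≠ 0) :
    chartOperator z (quarticDifferential f) (χ.symm w₀) (velocity χ.symm w₀) =
      coordOperator (fun w => r w * normalScale ^ 3) w₀ + normalScale * s w₀ := by
  have hzc : HolChart z := hz.1
  obtain ⟨G₁, ρ, hρ⟩ := hz.exists_normalFrame hp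
  let ν : ℂ → ℂ := z ∘ χ.symm
  have hN : ∀ᶠ w in 𝓝 w₀, w ∈ χ.target ∧ χ.symm w ∈ z.source :=
    (show ∀ᶠ w in 𝓝 w₀, w ∈ χ.target from χ.open_target.mem_nhds hw₀).and
      ((χ.continuousAt_symm hw₀).eventually (z.open_source.mem_nhds hp))
  have hν : AnalyticAt ℂ ν w₀ := analyticAt_of_eventually_mdifferentiableAt (hN.mono fun w hw =>
    (hzc.mdifferentiableAt hw.2).comp w (hχ.mdifferentiableAt_symm hw.1))
  have hform : chartForm z (χ.symm w₀) (velocity χ.symm w₀) = deriv ν w₀ :=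
    chartForm_velocity hz.1 (hχ.mdifferentiableAt_symm hw₀) hp
  have hν0 : deriv ν w₀ ≠ 0 := by
    rw [← hform]
    intro h0
    have h1 := chartForm_velocity hχ (hχ.mdifferentiableAt_symm hw₀) (χ.map_target hw₀)
    rw [deriv_chart_symm hw₀, eq_zero_of_chartForm_eq_zero hz.1 hp h0, chartForm, map_zero] at h1
    exact zero_ne_one (α := ℂ) h1
  obtain ⟨G₂, h₂⟩ := MovingFrame.normal_comp (y₀ := w₀) (ν := ν) hρ hν hν0
  have h₂' := h₂.congr_curve (γ' := fun w => f (χ.symm w)) (hN.mono fun w hw => by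
    simp only [ν, Function.comp_apply, z.left_inv hw.2])
  obtain ⟨hs, hr'⟩ := NormalFrame.unique hG h₂'
  have hn := normalScale_ne_zero
  have hZ := quarticDifferential_coeff_eventuallyEq hz.1 (z.map_source hp) hρ
  have hρ0 : ρ (ν w₀) ≠ 0 := fun h0 => hr (by rw [hr'.eq_of_nhds, h0, zero_mul])
  have key := coordOperator_comp (Z := fun y => ρ y * normalScale ^ 3)
    (W := fun w => r w * normalScale ^ 3) hν hν0 (hρ.analytic_r.mul analyticAt_const)
    (mul_ne_zero hρ0 (pow_ne_zero _ hn)) (hr'.mono fun w hw => by simp only [hw]; ring)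
  have e : chartOperator z (quarticDifferential f) (χ.symm w₀) (velocity χ.symm w₀) =
      coordOperator ((quarticDifferential f).coeff z) (z (χ.symm w₀)) * deriv ν w₀ ^ 2 := by
    rw [chartOperator, hform, coordOperator]
  rw [e, key, coordOperator_congr hZ, hs.eq_of_nhds]
  change coordOperator (fun w => ρ w * normalScale ^ 3) (ν w₀) * _ = _
  generalize coordOperator (fun w => ρ w * normalScale ^ 3) (ν w₀) = c
  field_simp
  ring

lemma chartOperator_velocity_of_eq_zero {z χ : OpenPartialHomeomorph S ℂ}
    (hχ : HolChart χ) {w₀ : ℂ} (hw₀ : w₀ ∈ χ.target)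
    (hp : χ.symm w₀ ∈ z.source) {σ : Differential 4 S} (hσ : σ.coeff χ w₀ = 0) :
    chartOperator z σ (χ.symm w₀) (velocity χ.symm w₀) = 0 := by
  have h0 : σ.coeff z (z (χ.symm w₀)) = 0 := by
    have h1 : ∀ v, σ.val (χ.symm w₀) v = 0 := Differential.ext_at
      (τ := Differential.zero 4 S) hχ hw₀ hσ
    have h2 : ∀ q, q = χ.symm w₀ → ∀ v, σ.val q v = 0 := by
      rintro _ rfl
      exact h1
    exact h2 _ (z.left_inv hp) _
  rw [chartOperator]
  simp [h0]

/-- Adapted charts exist wherever reduced frames exist: the Schwarzian derivative of the chart has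
to be a multiple of the invariant `s` of a normal frame. -/
lemma exists_isAdaptedChart [IsManifold 𝓘(ℂ) ω S] {f : S → Q3} {χ : OpenPartialHomeomorph S ℂ}
    (hχ : HolChart χ) {w₀ : ℂ} (hw₀ : w₀ ∈ χ.target) {G : ℂ → Sp} {s r : ℂ → ℂ}
    (hG : NormalFrame (fun w => f (χ.symm w)) w₀ G s r) :
    ∃ z, χ.symm w₀ ∈ z.source ∧ IsAdaptedChart f z := by
  have hn := normalScale_ne_zero
  -- for this Schwarzian derivative the anomaly `-(2 / m) S(z)` accounts for the whole of `s`
  obtain ⟨z, hz, hz0, hSz⟩ := exists_schwarzian_eq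
    (Q := fun w => -(normalScale / 2) * s w) (analyticAt_const.mul hG.analytic_s)
  obtain ⟨e, he0, heN, hez, hea, hes⟩ := exists_local_biholomorphism hz hz0
    (χ.open_target.mem_nhds hw₀)
  -- a normal frame in the new coordinate `z`
  have hinv : e.symm (z w₀) = w₀ := by rw [← hez, e.left_inv he0]
  have hzt : z w₀ ∈ e.target := by rw [← hez]; exact e.map_source he0
  have hid : ∀ᶠ w in 𝓝 w₀, e.symm (z w) = w := by
    filter_upwards [e.open_source.mem_nhds he0] with w hw
    rw [← hez, e.left_inv hw]
  have hd0 : deriv e.symm (z w₀) ≠ 0 := by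
    intro h0
    have h1 : HasDerivAt (fun w => e.symm (z w)) (deriv e.symm (z w₀) * deriv z w₀) w₀ :=
      (hes _ hzt).differentiableAt.hasDerivAt.comp w₀ hz.differentiableAt.hasDerivAt
    have h2 := h1.unique ((hasDerivAt_id w₀).congr_of_eventuallyEq hid)
    rw [h0, zero_mul] at h2
    exact zero_ne_one h2
  obtain ⟨G₁, h₁⟩ := MovingFrame.normal_comp (ν := e.symm) (y₀ := z w₀)
    (by rw [hinv]; exact hG) (hes _ hzt) hd0
  set s₁ : ℂ → ℂ := fun y => s (e.symm y) * deriv e.symm y ^ 2 -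
    2 / normalScale * schwarzian e.symm y with hs₁
  -- its invariant `s₁` vanishes, by uniqueness of normal frames in the old coordinate
  obtain ⟨G₂, h₂⟩ := MovingFrame.normal_comp (ν := z) (y₀ := w₀) h₁ hz hz0
  have hu := (NormalFrame.unique hG (h₂.congr_curve (γ' := fun w => f (χ.symm w))
    (hid.mono fun w hw => by simp only [hw]))).1
  have hs0 : ∀ᶠ w in 𝓝 w₀, s₁ (z w) = 0 := by
    filter_upwards [hu, hSz, hz.deriv.continuousAt.eventually_ne hz0] with w a1 a2 a3
    rw [a2] at a1
    have a4 : s₁ (z w) * deriv z w ^ 2 = 0 := by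
      have : 2 / normalScale * (-(normalScale / 2) * s w) = - s w := by
        field_simp
      rw [this] at a1
      linear_combination -a1
    exact (mul_eq_zero.1 a4).resolve_right (pow_ne_zero _ a3)
  have hs0' : (fun _ => 0) =ᶠ[𝓝 (z w₀)] s₁ := by
    have : ∀ᶠ w in 𝓝 (e.symm (z w₀)), s₁ (z w) = 0 := by rw [hinv]; exact hs0
    filter_upwards [(e.continuousAt_symm hzt).eventually this, e.open_target.mem_nhds hzt]
      with y h3 h4
    rw [← hez, e.right_inv h4] at h3
    exact h3.symm
  have h₃ := MovingFrame.congr_data h₁ EventuallyEq.rfl EventuallyEq.rfl hs0' EventuallyEq.rfl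
  -- shrink the chart to the domain of this frame
  obtain ⟨V, hVsub, hVo, hV⟩ := mem_nhds_iff.1 h₃.eventually
  let e' := e.restrOpen (e.source ∩ e ⁻¹' V) (e.isOpen_inter_preimage hVo)
  have hη : HolChart (χ ≫ₕ e') := by
    refine hχ.trans e' (fun w hw => hea w hw.1) fun y hy => hes y ?_
    exact e'.map_target hy |>.1 |> fun h => by
      have := e.map_source h
      rwa [show e (e'.symm y) = y from e'.right_inv hy] at this
  have hsrc : ∀ p ∈ (χ ≫ₕ e').source, p ∈ χ.source ∧ χ p ∈ e.source ∧ e (χ p) ∈ V :=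
    fun p hp => by
      rw [OpenPartialHomeomorph.trans_source] at hp
      exact ⟨hp.1, hp.2.1, hp.2.2.2⟩
  have hmf := MovingFrame.isReducedFrame (f := f) hη (χ ≫ₕ e').open_source subset_rfl
    (fun p hp => hVsub (hsrc p hp).2.2)
  refine ⟨χ ≫ₕ e', ?_, hη, _, hmf.1, fun p hp v => ?_⟩
  · rw [OpenPartialHomeomorph.trans_source]
    refine ⟨χ.map_target hw₀, ?_⟩
    change χ (χ.symm w₀) ∈ e'.source
    rw [χ.right_inv hw₀]
    refine ⟨he0, he0, ?_⟩
    change e w₀ ∈ V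
    rwa [hez]
  · rw [cartanForm, hmf.2 p hp v]
    have := neg_mul_normalScale
    ext i j
    fin_cases i <;> fin_cases j <;> simp [reducedForm]
    simp at this
    linear_combination (chartForm (χ ≫ₕ e') p v) * this

/-- The value of `𝔡(δ)` in a coordinate, in terms of the invariants `s` and `r` of a normal frame.
At a zero of `δ` the value is `0` by the convention for division by zero. -/
lemma projectiveOperator_coeff [IsManifold 𝓘(ℂ) ω S] {f : S → Q3}
    {χ : OpenPartialHomeomorph S ℂ} (hχ : HolChart χ) {w₀ : ℂ} (hw₀ : w₀ ∈ χ.target)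
    {G : ℂ → Sp} {s r : ℂ → ℂ} (hG : NormalFrame (fun w => f (χ.symm w)) w₀ G s r) :
    (projectiveOperator f (quarticDifferential f)).coeff χ w₀ = if r w₀ = 0 then 0 else
      coordOperator (fun w => r w * normalScale ^ 3) w₀ + normalScale * s w₀ := by
  have hex := exists_isAdaptedChart hχ hw₀ hG
  refine (dif_pos hex).trans ?_
  change chartOperator hex.choose (quarticDifferential f) (χ.symm w₀) (velocity χ.symm w₀) = _
  obtain ⟨hp, hz⟩ := hex.choose_spec
  split_ifs with hr
  · exact chartOperator_velocity_of_eq_zero hχ hw₀ hp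
      ((quarticDifferential_coeff hχ hw₀ hG).trans (by rw [hr, zero_mul]))
  · exact chartOperator_velocity hz hχ hw₀ hp hG hr

lemma projectiveOperator_coeff_of_not_exists {f : S → Q3} {σ : Differential 4 S}
    {χ : OpenPartialHomeomorph S ℂ} (hχ : HolChart χ) {w₀ : ℂ} (hw₀ : w₀ ∈ χ.target)
    (hG : ¬ ∃ G s r, NormalFrame (fun w => f (χ.symm w)) w₀ G s r) :
    (projectiveOperator f σ).coeff χ w₀ = 0 := by
  refine dif_neg ?_
  rintro ⟨z, hp, -, A, hA, -⟩
  exact hG ((exists_isReducedFrame_iff hχ hw₀).1 ⟨A, z.source, hp, hA⟩)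

end Operator

/-! ### The identity principle on a connected Riemann surface -/

/-- A property which holds near every point at which it holds on a set accumulating there, and which
holds near some point, holds everywhere. -/
lemma forall_of_eventually_of_frequently {X : Type*} [TopologicalSpace X] [PreconnectedSpace X]
    {P : X → Prop} (hP : ∀ p, (∃ᶠ q in 𝓝[≠] p, P q) → ∀ᶠ q in 𝓝 p, P q) {p₀ : X}
    (h₀ : ∀ᶠ q in 𝓝 p₀, P q) (p : X) : P p := by
  have hopen : IsOpen {p | ∀ᶠ q in 𝓝 p, P q} := isOpen_setOfPred_eventually_nhds
  have hclosed : IsClosed {p | ∀ᶠ q in 𝓝 p, P q} := by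
    refine isClosed_of_closure_subset fun p hp => ?_
    by_contra hn
    refine hn (hP p ?_)
    rw [mem_closure_iff_frequently] at hp
    rw [frequently_nhdsWithin_iff]
    refine hp.mono fun q hq => ⟨hq.self_of_nhds, ?_⟩
    rintro rfl
    exact hn hq
  have huniv := IsClopen.eq_univ ⟨hclosed, hopen⟩ ⟨p₀, h₀⟩
  have : p ∈ {p | ∀ᶠ q in 𝓝 p, P q} := by rw [huniv]; trivial
  exact Eventually.self_of_nhds this

/-- A holomorphic function vanishing on a set which accumulates at `w` vanishes near `w`. -/
lemma analytic_eventually_eq_zero_of_frequently {F : ℂ → ℂ} {w : ℂ} (hF : AnalyticAt ℂ F w)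
    (h : ∃ᶠ z in 𝓝[≠] w, F z = 0) : ∀ᶠ z in 𝓝 w, F z = 0 :=
  hF.eventually_eq_zero_or_eventually_ne_zero.resolve_right fun h' => h h'

section

variable {S : Type*} [TopologicalSpace S]

lemma frequently_symm {χ : OpenPartialHomeomorph S ℂ} {p : S} (hp : p ∈ χ.source) {P : S → Prop}
    (h : ∃ᶠ q in 𝓝[≠] p, P q) : ∃ᶠ w in 𝓝[≠] (χ p), P (χ.symm w) := by
  have ht : Tendsto χ (𝓝[≠] p) (𝓝[≠] (χ p)) := by
    refine tendsto_nhdsWithin_iff.2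
      ⟨(χ.continuousAt hp).tendsto.mono_left nhdsWithin_le_nhds, ?_⟩
    filter_upwards [self_mem_nhdsWithin, nhdsWithin_le_nhds (χ.open_source.mem_nhds hp)]
      with q h1 h2 h3
    exact h1 (χ.injOn h2 hp h3)
  refine ht.frequently ((h.and_eventually
    (nhdsWithin_le_nhds (χ.open_source.mem_nhds hp))).mono fun q hq => ?_)
  rw [χ.left_inv hq.2]
  exact hq.1

lemma eventually_of_eventually_symm {χ : OpenPartialHomeomorph S ℂ} {p : S} (hp : p ∈ χ.source)
    {P : S → Prop} (h : ∀ᶠ w in 𝓝 (χ p), P (χ.symm w)) : ∀ᶠ q in 𝓝 p, P q := by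
  filter_upwards [(χ.continuousAt hp).eventually h, χ.open_source.mem_nhds hp] with q h1 h2
  rwa [χ.left_inv h2] at h1

end

section Global

variable {S : Type*} [TopologicalSpace S] [ChartedSpace ℂ S]
variable {S' : Type*} [TopologicalSpace S'] [ChartedSpace ℂ S']

/-- The critical points of a nonconstant holomorphic map between Riemann surfaces are isolated. -/
lemma eventually_mfderiv_ne_zero [IsManifold 𝓘(ℂ) ω S] [T1Space S] [IsManifold 𝓘(ℂ) ω S']
    [PreconnectedSpace S'] {h : S' → S} (hh : MDifferentiable 𝓘(ℂ) 𝓘(ℂ) h)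
    (hnc : ¬ ∃ c, ∀ p, h p = c) (p : S') :
    ∀ᶠ q in 𝓝[≠] p, mfderiv 𝓘(ℂ) 𝓘(ℂ) h q ≠ 0 := by
  -- the coordinate expression of `h` around a point
  let F : S' → ℂ → ℂ := fun p => chartAt ℂ (h p) ∘ (h ∘ (chartAt ℂ p).symm)
  have hN : ∀ p, ∀ᶠ w in 𝓝 (chartAt ℂ p p), w ∈ (chartAt ℂ p).target ∧
      h ((chartAt ℂ p).symm w) ∈ (chartAt ℂ (h p)).source := by
    intro p
    have hpt := mem_chart_target ℂ p
    have hc : ContinuousAt (h ∘ (chartAt ℂ p).symm) (chartAt ℂ p p) :=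
      hh.continuous.continuousAt.comp ((chartAt ℂ p).continuousAt_symm hpt)
    filter_upwards [(chartAt ℂ p).open_target.mem_nhds hpt, hc.eventually
      ((chartAt ℂ (h p)).open_source.mem_nhds (by simp))] with w h1 h2
    exact ⟨h1, h2⟩
  have hmd : ∀ p w, w ∈ (chartAt ℂ p).target →
      MDifferentiableAt 𝓘(ℂ) 𝓘(ℂ) (h ∘ (chartAt ℂ p).symm) w := fun p w hw =>
    (hh _).comp w (HolChart.mdifferentiableAt_symm (IsManifold.chart_mem_maximalAtlas p) hw)
  have hF : ∀ p, AnalyticAt ℂ (F p) (chartAt ℂ p p) := fun p =>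
    analyticAt_of_eventually_mdifferentiableAt ((hN p).mono fun w hw =>
      (HolChart.mdifferentiableAt (IsManifold.chart_mem_maximalAtlas (h p)) hw.2).comp w
        (hmd p w hw.1))
  have hconst : ∀ p, (∀ᶠ w in 𝓝 (chartAt ℂ p p), F p w = chartAt ℂ (h p) (h p)) →
      ∀ᶠ q in 𝓝 p, h q = h p := fun p hp =>
    eventually_of_eventually_symm (mem_chart_source ℂ p) <| by
      filter_upwards [hp, hN p] with w h1 h2
      exact (chartAt ℂ (h p)).injOn h2.2 (mem_chart_source ℂ (h p)) h1
  by_contra hcrit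
  rw [not_eventually] at hcrit
  simp only [not_not] at hcrit
  have hderiv : ∀ᶠ w in 𝓝 (chartAt ℂ p p), deriv (F p) w = 0 := by
    refine analytic_eventually_eq_zero_of_frequently (hF p).deriv ?_
    refine ((frequently_symm (mem_chart_source ℂ p) hcrit).and_eventually
      (nhdsWithin_le_nhds (hN p))).mono fun w hw => ?_
    have h1 := chartForm_velocity (IsManifold.chart_mem_maximalAtlas (h p)) (hmd p w hw.2.1) hw.2.2
    have h2 : velocity (h ∘ (chartAt ℂ p).symm) w = 0 := by
      rw [← mfderiv_velocity (HolChart.mdifferentiableAt_symm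
        (IsManifold.chart_mem_maximalAtlas p) hw.2.1) (hh _), hw.1]
      rfl
    rw [h2, chartForm, map_zero] at h1
    exact h1.symm
  have hloc : ∀ᶠ q in 𝓝 p, h q = h p := by
    refine hconst p ?_
    have := eventually_eq_of_hasDerivAt_zero (f := F p) (w₀ := chartAt ℂ p p) (by
      filter_upwards [hderiv, (hF p).eventually_analyticAt] with w h1 h2
      rw [← h1]
      exact h2.differentiableAt.hasDerivAt)
    filter_upwards [this] with w hw
    rw [hw]
    simp [F]
  refine hnc ⟨h p, forall_of_eventually_of_frequently (fun q hq => ?_) hloc⟩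
  have hqc : h q = h p := by
    by_contra hne
    have : ∀ᶠ x in 𝓝 q, h x ≠ h p := hh.continuous.continuousAt.eventually_ne hne
    exact hq (nhdsWithin_le_nhds this)
  rw [← hqc]
  refine hconst q ?_
  have := analytic_eventually_eq_zero_of_frequently
    ((hF q).sub (analyticAt_const (v := chartAt ℂ (h q) (h q))))
    ((frequently_symm (mem_chart_source ℂ q) hq).mono fun w hw => by
      simp only [F, Pi.sub_apply, Function.comp_apply, hw, hqc, sub_self])
  exact this.mono fun w hw => sub_eq_zero.1 hw

/-- Holomorphic curves which are congruent on a set with an accumulation point are congruent. -/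
lemma congruent_of_eventually [IsManifold 𝓘(ℂ) ω S] [IsManifold 𝓘(ℂ) ω S'] [PreconnectedSpace S']
    {f : S → Q3} {f' : S' → Q3} (hf : IsHolomorphicCurve f) (hf' : IsHolomorphicCurve f')
    {h : S' → S} (hh : MDifferentiable 𝓘(ℂ) 𝓘(ℂ) h) {X : Sp} {p₀ : S'}
    (h₀ : ∀ᶠ q in 𝓝 p₀, f' q = X • f (h q)) (p : S') : f' p = X • f (h p) := by
  refine forall_of_eventually_of_frequently (P := fun q => f' q = X • f (h q)) ?_ h₀ p
  intro p hp
  obtain ⟨U, hU, A, hA⟩ := hf (h p)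
  obtain ⟨U', hU', A', hA'⟩ := hf' p
  let χ := chartAt ℂ p
  have hχ : HolChart χ := IsManifold.chart_mem_maximalAtlas _
  have hps : p ∈ χ.source := mem_chart_source _ _
  have hpt := χ.map_source hps
  have hN : ∀ᶠ q in 𝓝 p, q ∈ χ.source ∧ q ∈ U' ∧ h q ∈ U := by
    filter_upwards [χ.open_source.mem_nhds hps, hA'.isOpen.mem_nhds hU',
      hh.continuous.continuousAt.eventually (hA.isOpen.mem_nhds hU)] with q h1 h2 h3
    exact ⟨h1, h2, h3⟩
  have hN' : ∀ᶠ w in 𝓝 (χ p), w ∈ χ.target ∧ χ.symm w ∈ U' ∧ h (χ.symm w) ∈ U := by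
    filter_upwards [χ.open_target.mem_nhds hpt, (χ.symm.continuousAt hpt).eventually
      (by rw [χ.left_inv hps]; exact hN)] with w h1 h2
    exact ⟨h1, h2.2.1, h2.2.2⟩
  let B : ℂ → Matrix Idx Idx ℂ := fun w => (X * A (h (χ.symm w))).1⁻¹ * (A' (χ.symm w)).1
  have hA1 : ∀ i j, AnalyticAt ℂ (fun w => (A (h (χ.symm w))).1 i j) (χ p) := fun i j =>
    analyticAt_of_eventually_mdifferentiableAt (hN'.mono fun w hw =>
      ((hA.holomorphic i j).mdifferentiableAt (hA.isOpen.mem_nhds hw.2.2)).comp w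
        ((hh _).comp w (hχ.mdifferentiableAt_symm hw.1)))
  have hA2 : ∀ i j, AnalyticAt ℂ (fun w => (A' (χ.symm w)).1 i j) (χ p) := fun i j =>
    analyticAt_of_eventually_mdifferentiableAt (hN'.mono fun w hw =>
      ((hA'.holomorphic i j).mdifferentiableAt (hA'.isOpen.mem_nhds hw.2.1)).comp w
        (hχ.mdifferentiableAt_symm hw.1))
  have hB : ∀ i j, AnalyticAt ℂ (fun w => B w i j) (χ p) := by
    intro i j
    simp only [B, inv_eq_of_mem]
    simp only [Submonoid.coe_mul, Matrix.mul_apply, Matrix.transpose_apply]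
    exact Finset.analyticAt_fun_sum _ fun k _ => (Finset.analyticAt_fun_sum _ fun l _ =>
      (Finset.analyticAt_fun_sum _ fun m _ => analyticAt_const.mul
        (Finset.analyticAt_fun_sum _ fun n _ => analyticAt_const.mul (hA1 _ _))).mul
          analyticAt_const).mul (hA2 _ _)
  have hiff : ∀ᶠ w in 𝓝 (χ p), f' (χ.symm w) = X • f (h (χ.symm w)) ↔
      ∀ i j, B w (Sum.inr i) (Sum.inl j) = 0 := hN'.mono fun w hw =>
    smul_eq_iff X _ _ _ _ (hA.spans _ hw.2.2) (hA'.spans _ hw.2.1)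
  have hfreq := frequently_symm hps hp
  refine eventually_of_eventually_symm (χ := χ) hps ?_
  have hz : ∀ i j, ∀ᶠ w in 𝓝 (χ p), B w (Sum.inr i) (Sum.inl j) = 0 := fun i j =>
    analytic_eventually_eq_zero_of_frequently (hB _ _)
      ((hfreq.and_eventually (nhdsWithin_le_nhds hiff)).mono fun w hw => hw.2.1 hw.1 i j)
  filter_upwards [hiff, eventually_all.2 fun i => eventually_all.2 fun j => hz i j] with w h1 h2
  exact h1.2 h2

end Global

section Main

variable {S : Type*} [TopologicalSpace S] [ChartedSpace ℂ S]
variable {S' : Type*} [TopologicalSpace S'] [ChartedSpace ℂ S']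

/-! ### Comparison of the invariants of two curves -/

lemma inv_smul_smul (X : Sp) (P : Q3) : X⁻¹ • X • P = P := by
  apply Subtype.ext
  have h : (X⁻¹ : Sp).1 * X.1 = 1 := by rw [SymplecticGroup.coe_inv', X.inv_mul]
  rw [smul_val, smul_val, ← Submodule.map_comp, ← Matrix.mulVecLin_mul, h, Matrix.mulVecLin_one,
    Submodule.map_id]

lemma Differential.pullback_coeff {q : ℕ} (σ : Differential q S) {h : S' → S}
    (hh : MDifferentiable 𝓘(ℂ) 𝓘(ℂ) h) {χ : OpenPartialHomeomorph S' ℂ} (hχ : HolChart χ)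
    {η : OpenPartialHomeomorph S ℂ} (hsub : η.target ⊆ χ.target)
    (hη : ∀ w ∈ η.target, η.symm w = h (χ.symm w)) {w : ℂ} (hw : w ∈ η.target) :
    (σ.pullback h).coeff χ w = σ.coeff η w := by
  have h1 : η.symm =ᶠ[𝓝 w] h ∘ χ.symm := by
    filter_upwards [η.open_target.mem_nhds hw] with z hz using hη z hz
  rw [Differential.coeff_eq σ, σ.val_velocity_congr h1,
    ← mfderiv_velocity (hχ.mdifferentiableAt_symm (hsub hw)) (hh _)]
  rfl

lemma NormalFrame.of_smul {γ γ' : ℂ → Q3} {w₀ : ℂ} {G : ℂ → Sp} {s r : ℂ → ℂ}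
    (h : NormalFrame γ w₀ G s r) {X : Sp} (hX : ∀ᶠ w in 𝓝 w₀, γ' w = X • γ w) :
    NormalFrame γ' w₀ (fun w => X * G w) s r :=
  (MovingFrame.smul h X).congr_curve hX

/-- At a noncritical point of `h`, the curves `f` and `X • f ∘ h` have the same invariants. -/
lemma IsDominatedBy.coeff_eq [IsManifold 𝓘(ℂ) ω S] [IsManifold 𝓘(ℂ) ω S'] {f : S → Q3}
    {f' : S' → Q3} {h : S' → S} (hh : MDifferentiable 𝓘(ℂ) 𝓘(ℂ) h) {X : Sp}
    (hX : ∀ p, f' p = X • f (h p)) {χ : OpenPartialHomeomorph S' ℂ} (hχ : HolChart χ) {w₀ : ℂ}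
    (hw₀ : w₀ ∈ χ.target) (hd : mfderiv 𝓘(ℂ) 𝓘(ℂ) h (χ.symm w₀) ≠ 0) :
    ((quarticDifferential f).pullback h).coeff χ w₀ = (quarticDifferential f').coeff χ w₀ ∧
      ((projectiveOperator f (quarticDifferential f)).pullback h).coeff χ w₀ =
        (projectiveOperator f' (quarticDifferential f')).coeff χ w₀ := by
  obtain ⟨η, hη, hwη, hsub, hηh⟩ := exists_chart_comp hh hχ hw₀ hd
  rw [Differential.pullback_coeff _ hh hχ hsub hηh hwη,
    Differential.pullback_coeff _ hh hχ hsub hηh hwη]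
  have hcong : ∀ᶠ w in 𝓝 w₀, f' (χ.symm w) = X • f (η.symm w) := by
    filter_upwards [η.open_target.mem_nhds hwη] with w hw
    rw [hX, hηh w hw]
  by_cases hex : ∃ G s r, NormalFrame (fun w => f (η.symm w)) w₀ G s r
  · obtain ⟨G, s, r, hG⟩ := hex
    have hG' := NormalFrame.of_smul hG (γ' := fun w => f' (χ.symm w)) hcong
    rw [quarticDifferential_coeff hη hwη hG, quarticDifferential_coeff hχ hw₀ hG',
      projectiveOperator_coeff hη hwη hG, projectiveOperator_coeff hχ hw₀ hG']
    exact ⟨rfl, rfl⟩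
  · have hex' : ¬ ∃ G s r, NormalFrame (fun w => f' (χ.symm w)) w₀ G s r := by
      rintro ⟨G, s, r, hG⟩
      exact hex ⟨_, s, r, NormalFrame.of_smul hG (X := X⁻¹) (hcong.mono fun w hw => by
        rw [hw, inv_smul_smul])⟩
    rw [quarticDifferential_coeff_of_not_exists hη hwη hex,
      quarticDifferential_coeff_of_not_exists hχ hw₀ hex',
      projectiveOperator_coeff_of_not_exists hη hwη hex,
      projectiveOperator_coeff_of_not_exists hχ hw₀ hex']
    exact ⟨rfl, rfl⟩

/-- If `h` matches the invariants near a point at which the quartic differential of `f'` does not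
vanish, then `f'` and `f ∘ h` are congruent near this point. -/
lemma exists_congruent [IsManifold 𝓘(ℂ) ω S] [IsManifold 𝓘(ℂ) ω S'] {f : S → Q3}
    {f' : S' → Q3} {h : S' → S} (hh : MDifferentiable 𝓘(ℂ) 𝓘(ℂ) h)
    (hδ : ((quarticDifferential f).pullback h).AEq (quarticDifferential f'))
    (hop : ((projectiveOperator f (quarticDifferential f)).pullback h).AEq
      (projectiveOperator f' (quarticDifferential f')))
    {χ : OpenPartialHomeomorph S' ℂ} (hχ : HolChart χ) {w₀ : ℂ} (hw₀ : w₀ ∈ χ.target)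
    (h₀ : (quarticDifferential f').coeff χ w₀ ≠ 0)
    (h₁ : ((quarticDifferential f).pullback h).coeff χ w₀ ≠ 0) :
    ∃ X : Sp, ∀ᶠ w in 𝓝 w₀, f' (χ.symm w) = X • f (h (χ.symm w)) := by
  have hn := normalScale_ne_zero
  have hd : mfderiv 𝓘(ℂ) 𝓘(ℂ) h (χ.symm w₀) ≠ 0 := by
    intro hd
    refine h₁ ?_
    change (quarticDifferential f).val _ (mfderiv 𝓘(ℂ) 𝓘(ℂ) h (χ.symm w₀) _) = 0
    rw [hd]
    have := (quarticDifferential f).homogeneous (h (χ.symm w₀)) 0 0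
    rw [smul_zero, zero_pow (by norm_num), zero_mul] at this
    exact this
  obtain ⟨η, hη, hwη, hsub, hηh⟩ := exists_chart_comp hh hχ hw₀ hd
  have hex : ∃ G s r, NormalFrame (fun w => f (η.symm w)) w₀ G s r := by
    by_contra hex
    rw [Differential.pullback_coeff _ hh hχ hsub hηh hwη,
      quarticDifferential_coeff_of_not_exists hη hwη hex] at h₁
    exact h₁ rfl
  have hex' : ∃ G s r, NormalFrame (fun w => f' (χ.symm w)) w₀ G s r := by
    by_contra hex
    exact h₀ (quarticDifferential_coeff_of_not_exists hχ hw₀ hex)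
  obtain ⟨G, s, r, hG⟩ := hex
  obtain ⟨G', s', r', hG'⟩ := hex'
  have hηt : ∀ᶠ w in 𝓝 w₀, w ∈ η.target := η.open_target.mem_nhds hwη
  have hrr : r =ᶠ[𝓝 w₀] r' := by
    refine hG.analytic_r.continuousAt.eventuallyEq_nhds_iff_eventuallyEq_nhdsNE
      hG'.analytic_r.continuousAt |>.1 ?_
    filter_upwards [hδ.coeff_eventuallyEq hw₀, nhdsWithin_le_nhds hηt,
      nhdsWithin_le_nhds hG.eventually, nhdsWithin_le_nhds hG'.eventually] with w h1 h2 h3 h4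
    rw [Differential.pullback_coeff _ hh hχ hsub hηh h2, quarticDifferential_coeff hη h2 h3,
      quarticDifferential_coeff hχ (hsub h2) h4] at h1
    exact mul_right_cancel₀ (pow_ne_zero _ hn) h1
  have hr0 : r' w₀ ≠ 0 := fun hr => h₀ (by
    rw [quarticDifferential_coeff hχ hw₀ hG', hr, zero_mul])
  have hss : s =ᶠ[𝓝 w₀] s' := by
    refine hG.analytic_s.continuousAt.eventuallyEq_nhds_iff_eventuallyEq_nhdsNE
      hG'.analytic_s.continuousAt |>.1 ?_
    filter_upwards [hop.coeff_eventuallyEq hw₀, nhdsWithin_le_nhds hηt,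
      nhdsWithin_le_nhds hG.eventually, nhdsWithin_le_nhds hG'.eventually,
      nhdsWithin_le_nhds hrr.eventuallyEq_nhds,
      nhdsWithin_le_nhds (hG'.analytic_r.continuousAt.eventually_ne hr0)] with w h1 h2 h3 h4 h5 h6
    rw [Differential.pullback_coeff _ hh hχ hsub hηh h2, projectiveOperator_coeff hη h2 h3,
      projectiveOperator_coeff hχ (hsub h2) h4, h5.eq_of_nhds, if_neg h6, if_neg h6,
      coordOperator_congr (Z' := fun z => r' z * normalScale ^ 3)
        (h5.mono fun z hz => by simp only [hz])] at h1
    exact mul_left_cancel₀ hn (add_left_cancel h1)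
  obtain ⟨X, hX⟩ := NormalFrame.congruent hG
    (MovingFrame.congr_data hG' EventuallyEq.rfl EventuallyEq.rfl hss hrr)
  refine ⟨X, ?_⟩
  filter_upwards [hX, hηt] with w h1 h2
  rw [h1, hηh w h2]

end Main

end IsotropicCurves

end

theorem theoremC
    {S : Type*} [TopologicalSpace S] [T2Space S] [ConnectedSpace S] [ChartedSpace ℂ S]
    [IsManifold 𝓘(ℂ) ω S]
    {S' : Type*} [TopologicalSpace S'] [T2Space S'] [ConnectedSpace S'] [ChartedSpace ℂ S']
    [IsManifold 𝓘(ℂ) ω S']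
    (f : S → IsotropicCurves.Q3) (f' : S' → IsotropicCurves.Q3)
    (hf : IsotropicCurves.IsIsotropicCurve f) (hf' : IsotropicCurves.IsIsotropicCurve f')
    (hg : IsotropicCurves.IsGeneralType f) (hg' : IsotropicCurves.IsGeneralType f') :
    IsotropicCurves.IsDominatedBy f' f ↔
      ∃ h : S' → S, MDifferentiable 𝓘(ℂ) 𝓘(ℂ) h ∧
        ((IsotropicCurves.quarticDifferential f).pullback h).AEq
          (IsotropicCurves.quarticDifferential f') ∧
        ((IsotropicCurves.projectiveOperator f
            (IsotropicCurves.quarticDifferential f)).pullback h).AEq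
          (IsotropicCurves.projectiveOperator f'
            (IsotropicCurves.quarticDifferential f')) := by
  open IsotropicCurves Filter in
  constructor
  · rintro ⟨h, hh, X, hX⟩
    have hnc : ¬ ∃ c, ∀ p, h p = c := fun ⟨c, hc⟩ =>
      hf'.nonconstant ⟨X • f c, fun p => by rw [hX, hc]⟩
    have key : ∀ p : S', mfderiv 𝓘(ℂ) 𝓘(ℂ) h p ≠ 0 →
        (∀ v, ((quarticDifferential f).pullback h).val p v = (quarticDifferential f').val p v) ∧
        ∀ v, ((projectiveOperator f (quarticDifferential f)).pullback h).val p v =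
          (projectiveOperator f' (quarticDifferential f')).val p v := by
      intro p hd
      have hχ : HolChart (chartAt ℂ p) := IsManifold.chart_mem_maximalAtlas p
      obtain ⟨w, hw, hp⟩ : ∃ w ∈ (chartAt ℂ p).target, (chartAt ℂ p).symm w = p :=
        ⟨_, mem_chart_target ℂ p, (chartAt ℂ p).left_inv (mem_chart_source ℂ p)⟩
      generalize chartAt ℂ p = χ at hχ hw hp
      subst hp
      obtain ⟨h1, h2⟩ := IsDominatedBy.coeff_eq hh hX hχ hw hd
      exact ⟨Differential.ext_at hχ hw h1, Differential.ext_at hχ hw h2⟩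
    exact ⟨h, hh,
      eventually_codiscrete_iff.2 fun p => (eventually_mfderiv_ne_zero hh hnc p).mono fun q hq =>
        (key q hq).1,
      eventually_codiscrete_iff.2 fun p => (eventually_mfderiv_ne_zero hh hnc p).mono fun q hq =>
        (key q hq).2⟩
  · rintro ⟨h, hh, hδ, hop⟩
    -- as `δ'` is not almost everywhere zero, some point with `δ' ≠ 0` satisfies `h^* δ = δ'`
    obtain ⟨p, hp0, hp⟩ := ((not_eventually.1 hg').and_eventually hδ).exists
    have hχ : HolChart (chartAt ℂ p) := IsManifold.chart_mem_maximalAtlas p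
    have hps := mem_chart_source ℂ p
    have hpt := mem_chart_target ℂ p
    have hpi := (chartAt ℂ p).left_inv hps
    have hδp : ((quarticDifferential f).pullback h).coeff (chartAt ℂ p) (chartAt ℂ p p) =
        (quarticDifferential f').coeff (chartAt ℂ p) (chartAt ℂ p p) := by
      rw [Differential.coeff_eq, Differential.coeff_eq, hpi]
      exact hp _
    have hδ0 : (quarticDifferential f').coeff (chartAt ℂ p) (chartAt ℂ p p) ≠ 0 := by
      intro h0
      have := Differential.ext_at (τ := Differential.zero 4 S') hχ hpt h0
      rw [hpi] at this
      exact hp0 this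
    obtain ⟨X, hX⟩ := exists_congruent hh hδ hop hχ hpt hδ0 (by rw [hδp]; exact hδ0)
    exact ⟨h, hh, X, congruent_of_eventually hf.holomorphic hf'.holomorphic hh
      (eventually_of_eventually_symm hps hX)⟩
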